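/- Graphs are finite and may have loops and parallel edges. A biased graph is a pair $(G,\mathcal B)$, where $G$ is a graph and $\mathcal B$ is a set of cycles of $G$ (the balanced cycles) such that no theta subgraph of $G$ (three internally disjoint paths joining two distinct vertices) contains exactly two balanced cycles. For a group $\Gamma$, $(G,\mathcal B)$ is $\Gamma$-labellable if there are an orientation of the edges of $G$ and a map $\phi:E(G)\to\Gamma$ such that a cycle $C$ is in $\mathcal B$ if and only if some simple closed walk $e_1,\dots,e_\ell$ around $C$ satisfies $\prod_{i=1}^{\ell}\phi(e_i)^{\epsilon_i}=1$, where $\epsilon_i=1$ if $e_i$ is traversed forward and $\epsilon_i=-1$ otherwise. It is group-labellable if it is $\Gamma$-labellable for some group $\Gamma$. Deleting an edge $e$ removes $e$ from $G$ and removes from $\mathcal B$ all cycles containing $e$. Contracting a non-loop edge $e$ contracts $e$ in $G$, and a cycle $C$ of $G/e$ is balanced if $C\in\mathcal B$ or $E(C)\cup\{e\}$ is the edge set of a cycle in $\mathcal B$. Contracting a balanced loop means deleting it. Contracting an unbalanced loop $e$ at a vertex $x$ follows one of two fixed conventions: in the lift convention $e$ is deleted and all remaining cycles become balanced; in the frame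 convention $e$ is deleted, every edge from $x$ to a vertex $w\neq x$ becomes an unbalanced loop at $w$, every other loop at $x$ becomes balanced, and cycles avoiding $x$ keep their status. A proper minor is a biased graph obtained by a nonempty sequence of deletions and contractions. **Theorem.** Let $k\ge 2$ be an integer, and let $t=3$ or $t\ge 5$. There exists a biased graph $(G,\mathcal B)$, where $G$ has no loops, such that 1. the underlying simple graph of $G$ is the cycle $C_t$; 2. any two adjacent vertices of $G$ are joined by exactly $2k$ edges; 3. $(G,\mathcal B)$ is not group-labellable; 4. for every infinite group $\Gamma$, and under either convention for contracting unbalanced loops, every proper minor of $(G,\mathcal B)$ is $\Gamma$-labellable. -/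

import Mathlib

universe u v

open scoped Graph

namespace Graph

variable {α β : Type*}

/-- `G.IsWalk x L y`: the list `L` of steps `(edge, next vertex)` describes a walk in `G`
from `x` to `y`. -/
def IsWalk (G : Graph α β) : α → List (β × α) → α → Prop
  | x, [], y => x ∈ V(G) ∧ x = y
  | x, (e, z) :: L, y => G.IsLink e x z ∧ G.IsWalk z L y

/-- The set of edges used by a list of steps. -/
def stepEdges (L : List (β × α)) : Set β := {e | e ∈ L.map Prod.fst}

/-- A simple closed walk based at `x`: nonempty, no repeated edge, and no repeated vertex apart
from the return to `x`. A loop gives one of length 1, a pair of parallel edges one of length 2. -/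
structure IsSimpleClosedWalk (G : Graph α β) (x : α) (L : List (β × α)) : Prop where
  isWalk : G.IsWalk x L x
  ne_nil : L ≠ []
  edges_nodup : (L.map Prod.fst).Nodup
  vertices_nodup : (L.map Prod.snd).Nodup

/-- `C` is (the edge set of) a cycle of `G`. A cycle is determined by its edge set. -/
def IsCycle (G : Graph α β) (C : Set β) : Prop :=
  ∃ x L, G.IsSimpleClosedWalk x L ∧ stepEdges L = C

/-- A path from `x` to `y`: a walk without repeated vertices. -/
structure IsPath (G : Graph α β) (x : α) (L : List (β × α)) (y : α) : Prop where
  isWalk : G.IsWalk x L y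
  vertices_nodup : (x :: L.map Prod.snd).Nodup

/-- Two paths from a common start to `y` are internally disjoint (and distinct): they share no
edge, and `y` is the only vertex that both visit after the start. -/
def InternallyDisjoint (y : α) (L M : List (β × α)) : Prop :=
  Disjoint (stepEdges L) (stepEdges M) ∧
    ∀ z, z ∈ L.map Prod.snd → z ∈ M.map Prod.snd → z = y

/-- Three internally disjoint paths `P`, `Q`, `R` between distinct vertices `x`, `y`:
a theta subgraph of `G`. Its cycles are the unions of two of the three paths. -/
structure IsTheta (G : Graph α β) (x y : α) (P Q R : List (β × α)) : Prop where
  ne : x ≠ y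
  isPath₁ : G.IsPath x P y
  isPath₂ : G.IsPath x Q y
  isPath₃ : G.IsPath x R y
  disjoint₁₂ : InternallyDisjoint y P Q
  disjoint₁₃ : InternallyDisjoint y P R
  disjoint₂₃ : InternallyDisjoint y Q R

/-- A group labelling of `G`: an orientation of the edges together with a label in `Γ` for each
edge. The values outside `E(G)` are irrelevant. -/
structure GroupLabelling (G : Graph α β) (Γ : Type*) where
  tail : β → α
  head : β → α
  isLink : ∀ e ∈ E(G), G.IsLink e (tail e) (head e)
  label : β → Γ

open Classical in
/-- The value `φ(W)` of a walk starting at `x`: the product, in order, of the labels of its edges,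
inverted where the edge is traversed backward. (A loop is read forward; whether the closed walk
along a single loop has value `1` does not depend on this.) -/
noncomputable def GroupLabelling.value {G : Graph α β} {Γ : Type*} [Group Γ]
    (φ : G.GroupLabelling Γ) : α → List (β × α) → Γ
  | _, [] => 1
  | x, (e, z) :: L => (if φ.tail e = x then φ.label e else (φ.label e)⁻¹) * φ.value z L

/-- The set of cycles `C` of `G` such that some simple closed walk around `C` has value `1`. -/
def GroupLabelling.balancedCycles {G : Graph α β} {Γ : Type*} [Group Γ]
    (φ : G.GroupLabelling Γ) : Set (Set β) :=
  {C | ∃ x L, G.IsSimpleClosedWalk x L ∧ stepEdges L = C ∧ φ.value x L = 1}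

open Classical in
/-- Contraction of an edge `e` with ends `x`, `y`: delete `e` and identify `y` with `x`. -/
noncomputable def contractLink (G : Graph α β) (e : β) (x y : α) : Graph α β :=
  (G.deleteEdges {e}).map (fun z ↦ if z = y then x else z)

/-- The graph of the frame contraction of an unbalanced loop `e` at `x`: delete `e`, and replace
every edge joining `x` to a vertex `w ≠ x` by a loop at `w`. -/
def contractLoopFrame (G : Graph α β) (e : β) (x : α) : Graph α β where
  vertexSet := V(G)
  IsLink f y z := f ≠ e ∧ ((G.IsLink f y z ∧ y ≠ x ∧ z ≠ x) ∨ (G.IsLoopAt f x ∧ y = x ∧ z = x) ∨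
    (G.IsLink f x y ∧ y ≠ x ∧ z = y))
  isLink_symm f _ := ⟨by
    rintro y z ⟨hf, ⟨h, hy, hz⟩ | ⟨h, rfl, rfl⟩ | ⟨h, hy, rfl⟩⟩
    · exact ⟨hf, Or.inl ⟨h.symm, hz, hy⟩⟩
    · exact ⟨hf, Or.inr (Or.inl ⟨h, rfl, rfl⟩)⟩
    · exact ⟨hf, Or.inr (Or.inr ⟨h, hy, rfl⟩)⟩⟩
  eq_or_eq_of_isLink_of_isLink := by
    rintro f a b c d ⟨-, h⟩ ⟨-, h'⟩
    simp only [Graph.IsLoopAt] at h h'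
    rcases h with ⟨h, ha, hb⟩ | ⟨h, ha, hb⟩ | ⟨h, ha, hb⟩ <;>
      rcases h' with ⟨h', hc, hd⟩ | ⟨h', hc, hd⟩ | ⟨h', hc, hd⟩ <;>
      have := h.eq_and_eq_or_eq_and_eq h' <;> grind
  left_mem_of_isLink := by
    rintro f y z ⟨-, ⟨h, -⟩ | ⟨h, rfl, -⟩ | ⟨h, -⟩⟩
    · exact h.left_mem
    · exact h.left_mem
    · exact h.right_mem

end Graph

/-- A graph (loops and parallel edges allowed) with a distinguished collection of sets of edges,
meant to be the edge sets of the balanced cycles. -/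
structure MarkedGraph (α β : Type*) where
  graph : Graph α β
  balanced : Set (Set β)

/-- The two conventions for contracting an unbalanced loop. -/
inductive LoopRule
  | lift
  | frame

namespace MarkedGraph

variable {α β : Type*}

/-- `Ω` is a biased graph: the graph is finite, the distinguished sets are cycles, and no theta
subgraph has exactly two balanced cycles. (The paths of a theta subgraph can be listed in any
order, so the implication below excludes each of the three ways to have exactly two.) -/
structure IsBiased (Ω : MarkedGraph α β) : Prop where
  finite_vertexSet : V(Ω.graph).Finite
  finite_edgeSet : E(Ω.graph).Finite
  isCycle : ∀ C ∈ Ω.balanced, Ω.graph.IsCycle C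
  theta : ∀ x y P Q R, Ω.graph.IsTheta x y P Q R →
    Graph.stepEdges P ∪ Graph.stepEdges Q ∈ Ω.balanced →
    Graph.stepEdges P ∪ Graph.stepEdges R ∈ Ω.balanced →
    Graph.stepEdges Q ∪ Graph.stepEdges R ∈ Ω.balanced

/-- `Ω` is `Γ`-labellable: some group labelling has exactly the given balanced cycles. -/
def Labellable (Ω : MarkedGraph α β) (Γ : Type*) [Group Γ] : Prop :=
  ∃ φ : Ω.graph.GroupLabelling Γ, φ.balancedCycles = Ω.balanced

/-- `Ω` is `Γ`-labellable for some group `Γ`. -/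
def GroupLabellable (Ω : MarkedGraph α β) : Prop :=
  ∃ (Γ : Type u) (_ : Group Γ), Ω.Labellable Γ

/-- Deletion of the edge `e`. -/
def delete (Ω : MarkedGraph α β) (e : β) : MarkedGraph α β where
  graph := Ω.graph.deleteEdges {e}
  balanced := {C | C ∈ Ω.balanced ∧ e ∉ C}

/-- Contraction of a non-loop edge `e` with ends `x`, `y`. -/
noncomputable def contractLink (Ω : MarkedGraph α β) (e : β) (x y : α) : MarkedGraph α β where
  graph := Ω.graph.contractLink e x y
  balanced := {C | (Ω.graph.contractLink e x y).IsCycle C ∧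
    (C ∈ Ω.balanced ∨ C ∪ {e} ∈ Ω.balanced)}

/-- Contraction of an unbalanced loop `e` at `x`. In the lift convention `e` is deleted and every
remaining cycle becomes balanced. In the frame convention `e` is deleted, every edge from `x` to
another vertex `w` becomes an unbalanced loop at `w`, and the other loops at `x` become balanced;
cycles that avoid `x` are balanced if and only if they were. -/
def contractLoop (Ω : MarkedGraph α β) (e : β) (x : α) : LoopRule → MarkedGraph α β
  | .lift =>
    { graph := Ω.graph.deleteEdges {e}
      balanced := {C | (Ω.graph.deleteEdges {e}).IsCycle C} }
  | .frame =>
    { graph := Ω.graph.contractLoopFrame e x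
      balanced := {C | (C ∈ Ω.balanced ∧ ∀ f ∈ C, ¬ Ω.graph.Inc f x) ∨
        ∃ f, f ≠ e ∧ Ω.graph.IsLoopAt f x ∧ C = {f}} }

/-- `Ω.IsStep r Ω'`: `Ω'` arises from `Ω` by deleting or contracting one edge. -/
inductive IsStep (r : LoopRule) : MarkedGraph α β → MarkedGraph α β → Prop
  | delete {Ω : MarkedGraph α β} {e : β} (he : e ∈ E(Ω.graph)) : IsStep r Ω (Ω.delete e)
  | contractLink {Ω : MarkedGraph α β} {e : β} {x y : α} (he : Ω.graph.IsLink e x y)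
      (hxy : x ≠ y) : IsStep r Ω (Ω.contractLink e x y)
  | contractBalancedLoop {Ω : MarkedGraph α β} {e : β} {x : α} (he : Ω.graph.IsLoopAt e x)
      (hb : {e} ∈ Ω.balanced) : IsStep r Ω (Ω.delete e)
  | contractUnbalancedLoop {Ω : MarkedGraph α β} {e : β} {x : α} (he : Ω.graph.IsLoopAt e x)
      (hb : {e} ∉ Ω.balanced) : IsStep r Ω (Ω.contractLoop e x r)

/-- `Ω'` is a proper minor of `Ω`: it arises by a nonempty sequence of deletions and
contractions, unbalanced loops being contracted according to `r`. -/
def HasProperMinor (r : LoopRule) (Ω Ω' : MarkedGraph α β) : Prop :=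
  Relation.TransGen (IsStep r) Ω Ω'

end MarkedGraph

/-! The balanced cycles come from a triangulated sphere, the bipyramid over a cycle of length `2 *
(n + 2)` with `k = n + 2`. Its vertices have three colours: the two apices, and the two alternating
colours of the rim. So its edges fall into three classes of size `2 * k`, and each triangle takes
one edge from each class. The classes become the parallel classes of a thick triangle, and the faces
become Hamiltonian cycles of it. For longer cycles the rim edges are subdivided. All faces except
one, the hole, are declared balanced.

Faces sharing two edges coincide, so no theta contains two balanced cycles, and the graph is biased.
In any labelling with all other faces of product 1, the relations propagate around the sphere and
force product 1 on the hole (`prod_hole`); hence the graph is not group-labellable.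

Labellability over a nontrivial group passes to minors, so only one deletion or one contraction
matters. After deleting an edge, only the faces avoiding it count. A second face through that edge
may then also be declared unbalanced, and with two holes the remaining faces can be realized
(`realizable₃_compl_pair`). After contracting an edge, only the faces through it count, and they are
obtained from a labelling balancing every face by spoiling other edges (`realizable_through`).
Unwanted balanced cycles are prevented by generic labels, which an infinite group supplies
(`exists_forall_not_of_update`).

Balance is handled by potentials throughout (`mem_balancedCycles_iff`), since these do not depend on
the start or direction of a closed walk. -/

namespace Graph

variable {α β : Type*} {G H : Graph α β} {x y z : α} {L M : List (β × α)} {e : β} {C : Set β}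

/-! ### Walks, paths and cycles -/

@[simp] lemma stepEdges_nil : stepEdges ([] : List (β × α)) = ∅ := by
  ext; simp [stepEdges]

@[simp] lemma stepEdges_cons (s : β × α) (L : List (β × α)) :
    stepEdges (s :: L) = insert s.1 (stepEdges L) := by
  ext; simp [stepEdges]

@[simp] lemma stepEdges_append (L M : List (β × α)) :
    stepEdges (L ++ M) = stepEdges L ∪ stepEdges M := by
  ext; simp [stepEdges]

lemma mem_stepEdges : e ∈ stepEdges L ↔ e ∈ L.map Prod.fst := Iff.rfl

lemma IsWalk.append (hL : G.IsWalk x L y) (hM : G.IsWalk y M z) : G.IsWalk x (L ++ M) z := by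
  induction L generalizing x with
  | nil => obtain ⟨-, rfl⟩ := hL; exact hM
  | cons s L ih => exact ⟨hL.1, ih hL.2⟩

lemma isWalk_append : G.IsWalk x (L ++ M) z ↔ ∃ y, G.IsWalk x L y ∧ G.IsWalk y M z := by
  refine ⟨fun h ↦ ?_, fun ⟨y, h, h'⟩ ↦ h.append h'⟩
  induction L generalizing x with
  | nil =>
    refine ⟨x, ⟨?_, rfl⟩, h⟩
    cases M with
    | nil => exact h.1
    | cons s M => exact h.1.left_mem
  | cons s L ih =>
    obtain ⟨y, h₁, h₂⟩ := ih h.2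
    exact ⟨y, ⟨h.1, h₁⟩, h₂⟩

lemma IsWalk.right_mem_vertices (h : G.IsWalk x L y) (hL : L ≠ []) : y ∈ L.map Prod.snd := by
  induction L generalizing x with
  | nil => exact absurd rfl hL
  | cons s L ih =>
    by_cases hL' : L = []
    · subst hL'; simpa using h.2.2.symm
    · exact List.mem_cons_of_mem _ (ih h.2 hL')

lemma IsWalk.mono (h : G.IsWalk x L y) (hx : x ∈ V(G) → x ∈ V(H))
    (hGH : ∀ e ∈ stepEdges L, ∀ a b, a ∈ x :: L.map Prod.snd → b ∈ x :: L.map Prod.snd →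
      G.IsLink e a b → H.IsLink e a b) :
    H.IsWalk x L y := by
  induction L generalizing x with
  | nil => exact ⟨hx h.1, h.2⟩
  | cons s L ih =>
    have hl := hGH s.1 (by simp) x s.2 (by simp) (by simp) h.1
    refine ⟨hl, ih h.2 (fun _ ↦ hl.right_mem) fun e he a b ha hb ↦
      hGH e (by simp [he]) a b ?_ ?_⟩
    · exact List.mem_cons_of_mem _ ha
    · exact List.mem_cons_of_mem _ hb

lemma IsWalk.exists_inc (h : G.IsWalk x L y) (hz : z ∈ L.map Prod.snd) :
    ∃ e ∈ stepEdges L, G.Inc e z := by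
  induction L generalizing x with
  | nil => simp at hz
  | cons s L ih =>
    rcases List.mem_cons.1 hz with rfl | hz
    · exact ⟨s.1, by simp, h.1.inc_right⟩
    · obtain ⟨e, he, hi⟩ := ih h.2 hz
      exact ⟨e, by simp [he], hi⟩

lemma IsWalk.mem_of_inc (h : G.IsWalk x L y) (he : e ∈ stepEdges L) (hz : G.Inc e z) :
    z ∈ x :: L.map Prod.snd := by
  induction L generalizing x with
  | nil => simp at he
  | cons s L ih =>
    rw [stepEdges_cons] at he
    rcases he with rfl | he
    · rcases hz.eq_or_eq_of_isLink h.1 with rfl | rfl <;> simp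
    · exact List.mem_cons_of_mem _ (ih h.2 he)

lemma IsWalk.stepEdges_subset (h : G.IsWalk x L y) : stepEdges L ⊆ E(G) := by
  induction L generalizing x with
  | nil => simp
  | cons s L ih =>
    rw [stepEdges_cons]
    exact Set.insert_subset h.1.edge_mem (ih h.2)

lemma IsPath.eq_nil (h : G.IsPath x L x) : L = [] := by
  by_contra hL
  exact (List.nodup_cons.1 h.vertices_nodup).1 (h.isWalk.right_mem_vertices hL)

lemma IsSimpleClosedWalk.mem_vertices_iff (h : G.IsSimpleClosedWalk x L) :
    z ∈ L.map Prod.snd ↔ ∃ e ∈ stepEdges L, G.Inc e z := by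
  refine ⟨h.isWalk.exists_inc, fun ⟨e, he, hz⟩ ↦ ?_⟩
  rcases List.mem_cons.1 (h.isWalk.mem_of_inc he hz) with rfl | h'
  · exact h.isWalk.right_mem_vertices h.ne_nil
  · exact h'

lemma IsCycle.finite (h : G.IsCycle C) : C.Finite := by
  obtain ⟨x, L, -, rfl⟩ := h
  exact List.finite_toSet _

lemma IsCycle.nonempty (h : G.IsCycle C) : C.Nonempty := by
  obtain ⟨x, L, h, rfl⟩ := h
  cases L with
  | nil => exact absurd rfl h.ne_nil
  | cons s L => exact ⟨s.1, by simp⟩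

lemma IsCycle.subset_edgeSet (h : G.IsCycle C) : C ⊆ E(G) := by
  obtain ⟨x, L, h, rfl⟩ := h
  exact h.isWalk.stepEdges_subset

/-- The vertices of a cycle, or more generally the ends of the edges of a set. -/
def endSet (G : Graph α β) (C : Set β) : Set α := {z | ∃ e ∈ C, G.Inc e z}

/-- A cycle has as many vertices as edges. -/
lemma IsCycle.ncard_endSet (h : G.IsCycle C) : (G.endSet C).ncard = C.ncard := by
  classical
  obtain ⟨x, L, h, rfl⟩ := h
  have h₁ : G.endSet (stepEdges L) = (L.map Prod.snd).toFinset := by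
    ext z; rw [List.coe_toFinset]; exact h.mem_vertices_iff.symm
  have h₂ : stepEdges L = (L.map Prod.fst).toFinset := by
    ext z; rw [List.coe_toFinset]; rfl
  rw [h₁, h₂, Set.ncard_coe_finset, Set.ncard_coe_finset,
    List.toFinset_card_of_nodup h.vertices_nodup, List.toFinset_card_of_nodup h.edges_nodup]
  simp

lemma IsCycle.finite_endSet (h : G.IsCycle C) : (G.endSet C).Finite := by
  refine Set.finite_of_ncard_pos ?_
  rw [h.ncard_endSet]
  exact (Set.ncard_pos h.finite).2 h.nonempty

/-- A simple closed walk can be started at any of its vertices. -/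
lemma IsSimpleClosedWalk.exists_rotate (h : G.IsSimpleClosedWalk x L)
    (hz : z ∈ L.map Prod.snd) :
    ∃ M, G.IsSimpleClosedWalk z M ∧ stepEdges M = stepEdges L := by
  obtain ⟨⟨e, z⟩, hs, rfl⟩ := List.mem_map.1 hz
  obtain ⟨L₁, L₂, rfl⟩ := List.append_of_mem hs
  rw [List.append_cons] at h ⊢
  have hp : (L₂ ++ (L₁ ++ [(e, z)])).Perm (L₁ ++ [(e, z)] ++ L₂) := List.perm_append_comm
  refine ⟨L₂ ++ (L₁ ++ [(e, z)]), ⟨?_, by simp, ?_, ?_⟩, ?_⟩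
  · obtain ⟨y, h₁, h₂⟩ := isWalk_append.1 h.isWalk
    obtain ⟨w, h₃, h₄⟩ := isWalk_append.1 h₁
    obtain rfl : z = y := h₄.2.2
    exact h₂.append h₁
  · exact (hp.map _).nodup_iff.2 h.edges_nodup
  · exact (hp.map _).nodup_iff.2 h.vertices_nodup
  · rw [stepEdges_append, stepEdges_append _ L₂, Set.union_comm]

/-- A cycle through a loop consists of that loop. -/
lemma IsCycle.eq_singleton (h : G.IsCycle C) (he : e ∈ C) (hl : G.IsLoopAt e x) : C = {e} := by
  obtain ⟨w, L, h, rfl⟩ := h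
  obtain ⟨M, h, hM⟩ := h.exists_rotate (h.mem_vertices_iff.2 ⟨e, he, hl.inc⟩)
  rw [← hM] at he ⊢
  clear hM
  obtain ⟨⟨e, z⟩, hs, rfl⟩ := List.mem_map.1 he
  obtain ⟨L₁, L₂, rfl⟩ := List.append_of_mem hs
  obtain ⟨y, h₁, h₂⟩ := isWalk_append.1 h.isWalk
  obtain rfl := hl.eq_of_inc h₂.1.inc_left
  obtain rfl := hl.eq_of_inc h₂.1.inc_right
  have hn := h.vertices_nodup
  simp only [List.map_append, List.map_cons, List.nodup_append, List.nodup_cons] at hn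
  have h₁' : L₁ = [] := by
    by_contra hL
    exact hn.2.2 _ (h₁.right_mem_vertices hL) _ (by simp) rfl
  have h₂' : L₂ = [] := by
    by_contra hL
    exact hn.2.1.1 (h₂.2.right_mem_vertices hL)
  simp [h₁', h₂']

lemma IsLoopAt.isCycle (h : G.IsLoopAt e x) : G.IsCycle {e} :=
  ⟨x, [(e, x)], ⟨⟨h, h.vertex_mem, rfl⟩, by simp, by simp, by simp⟩, by simp⟩

lemma IsCycle.mono (h : G.IsCycle C) (hV : V(G) ⊆ V(H))
    (hGH : ∀ e ∈ C, ∀ a b, G.IsLink e a b → H.IsLink e a b) : H.IsCycle C := by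
  obtain ⟨x, L, h, rfl⟩ := h
  exact ⟨x, L, ⟨h.isWalk.mono (fun hx ↦ hV hx) fun e he a b _ _ ↦ hGH e he a b, h.ne_nil,
    h.edges_nodup, h.vertices_nodup⟩, rfl⟩

lemma isCycle_deleteEdges : (G.deleteEdges {e}).IsCycle C ↔ G.IsCycle C ∧ e ∉ C := by
  refine ⟨fun h ↦ ⟨h.mono (by simp) fun f _ a b hf ↦ ?_, fun he ↦ ?_⟩, fun ⟨h, he⟩ ↦
    h.mono (by simp) fun f hf a b hl ↦ ?_⟩
  · exact deleteEdges_le.isLink_mono hf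
  · simpa using h.subset_edgeSet he
  · simp only [deleteEdges_isLink, Set.mem_singleton_iff]
    exact ⟨hl, fun h ↦ he (h ▸ hf)⟩

/-! ### Potentials of group labellings -/

namespace GroupLabelling

variable {Γ : Type*} [Group Γ]

/-- A potential for the labelling `φ` on a set `C` of edges. -/
def IsPotential (φ : G.GroupLabelling Γ) (C : Set β) (p : α → Γ) : Prop :=
  ∀ e ∈ C, p (φ.tail e) * φ.label e = p (φ.head e)

open Classical in
lemma IsPotential.mul_step {φ : G.GroupLabelling Γ} {p : α → Γ} (hp : φ.IsPotential C p)
    (he : e ∈ C) (hl : G.IsLink e x y) :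
    p x * (if φ.tail e = x then φ.label e else (φ.label e)⁻¹) = p y := by
  have h := hp e he
  rcases (φ.isLink e hl.edge_mem).eq_and_eq_or_eq_and_eq hl with ⟨h₁, h₂⟩ | ⟨h₁, h₂⟩
  · rw [if_pos h₁, ← h₁, ← h₂, h]
  -- Here `tail e = y`, so `tail e = x` can hold only when `e` is a loop.
  · split_ifs with h₃
    · rw [h₃, h₂] at h
      rw [h, ← h₁, h₃]
    · rw [← h₁, ← h₂, ← h, mul_inv_cancel_right]

lemma IsPotential.mul_value {φ : G.GroupLabelling Γ} {p : α → Γ} (hp : φ.IsPotential C p)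
    (hL : stepEdges L ⊆ C) (h : G.IsWalk x L y) : p x * φ.value x L = p y := by
  induction L generalizing x with
  | nil => rw [value, mul_one, h.2]
  | cons s L ih =>
    obtain ⟨e, z⟩ := s
    rw [stepEdges_cons, Set.insert_subset_iff] at hL
    rw [value, ← mul_assoc, hp.mul_step hL.1 h.1, ih hL.2 h.2]

lemma IsPotential.congr {φ : G.GroupLabelling Γ} {p q : α → Γ} (hp : φ.IsPotential C p)
    (hC : C ⊆ E(G)) (h : ∀ z ∈ G.endSet C, p z = q z) : φ.IsPotential C q := by
  intro e he
  have hl := φ.isLink e (hC he)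
  rw [← h _ ⟨e, he, hl.inc_left⟩, ← h _ ⟨e, he, hl.inc_right⟩]
  exact hp e he

open Classical in
lemma isPotential_of_step {φ : G.GroupLabelling Γ} {p : α → Γ} (hl : G.IsLink e x y)
    (h : p x * (if φ.tail e = x then φ.label e else (φ.label e)⁻¹) = p y) :
    p (φ.tail e) * φ.label e = p (φ.head e) := by
  rcases (φ.isLink e hl.edge_mem).eq_and_eq_or_eq_and_eq hl with ⟨h₁, h₂⟩ | ⟨h₁, h₂⟩
  · rw [if_pos h₁] at h
    rw [h₁, h₂, h]
  · split_ifs at h with h₃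
    · rw [h₃, h₂, h, ← h₁, h₃]
    · rw [h₁, h₂, ← h, inv_mul_cancel_right]

/-- The start of a path does not recur, so its value can be overwritten once a potential on the rest
is known. -/
lemma _root_.Graph.IsPath.exists_isPotential (φ : G.GroupLabelling Γ) (h : G.IsPath x L y)
    (g : Γ) : ∃ p, p x = g ∧ φ.IsPotential (stepEdges L) p := by
  classical
  induction L generalizing x g with
  | nil => exact ⟨fun _ ↦ g, rfl, by simp [IsPotential]⟩
  | cons s L ih =>
    obtain ⟨e, z⟩ := s
    have hn := List.nodup_cons.1 h.vertices_nodup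
    obtain ⟨p, hpz, hp⟩ := ih ⟨h.isWalk.2, hn.2⟩
      (g * (if φ.tail e = x then φ.label e else (φ.label e)⁻¹))
    have hxz : z ≠ x := fun h' ↦ hn.1 (by simp [h'])
    refine ⟨Function.update p x g, by simp, ?_⟩
    intro f hf
    rw [stepEdges_cons] at hf
    rcases hf with rfl | hf
    · refine isPotential_of_step h.isWalk.1 ?_
      rw [Function.update_self, Function.update_of_ne hxz, hpz]
    · refine hp.congr h.isWalk.2.stepEdges_subset (fun w ⟨e', he', hw⟩ ↦ ?_) f hf
      rw [Function.update_of_ne]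
      rintro rfl
      exact hn.1 (h.isWalk.2.mem_of_inc he' hw)

/-- A cycle is balanced if and only if it has a potential. -/
theorem mem_balancedCycles_iff (φ : G.GroupLabelling Γ) :
    C ∈ φ.balancedCycles ↔ G.IsCycle C ∧ ∃ p, φ.IsPotential C p := by
  classical
  constructor
  · rintro ⟨x, L, h, rfl, hv⟩
    refine ⟨⟨x, L, h, rfl⟩, ?_⟩
    cases L with
    | nil => exact absurd rfl h.ne_nil
    | cons s L =>
      obtain ⟨e, z⟩ := s
      -- Without its first edge the closed walk is a path. Normalized so that `x` would get value 1
      -- before the first step, its potential returns to 1 at `x` exactly because the walk has value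
      -- 1.
      obtain ⟨p, hpz, hp⟩ := IsPath.exists_isPotential φ ⟨h.isWalk.2, h.vertices_nodup⟩
        (if φ.tail e = x then φ.label e else (φ.label e)⁻¹)
      refine ⟨p, fun f hf ↦ ?_⟩
      rw [stepEdges_cons] at hf
      rcases hf with rfl | hf
      · refine isPotential_of_step h.isWalk.1 ?_
        rw [← hp.mul_value subset_rfl h.isWalk.2, hpz]
        rw [value] at hv
        rw [hv, one_mul]
      · exact hp f hf
  · rintro ⟨⟨x, L, h, rfl⟩, p, hp⟩
    exact ⟨x, L, h, rfl, by simpa using hp.mul_value subset_rfl h.isWalk⟩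

end GroupLabelling

/-! ### Cycles of a contraction -/

open Classical in
/-- The vertex map of the contraction that identifies `y` with `x`. -/
noncomputable def mergeVertex (x y : α) (z : α) : α := if z = y then x else z

lemma mergeVertex_right : mergeVertex x y y = x := by simp [mergeVertex]

lemma mergeVertex_left : mergeVertex x y x = x := by simp [mergeVertex]

lemma mergeVertex_of_ne (h : z ≠ y) : mergeVertex x y z = z := by simp [mergeVertex, h]

lemma mergeVertex_eq_left_iff : mergeVertex x y z = x ↔ z = x ∨ z = y := by
  unfold mergeVertex; split_ifs with h <;> simp [h]

lemma eq_of_mergeVertex_eq {w : α} (h : mergeVertex x y z = w) (hw : w ≠ x) : z = w := by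
  unfold mergeVertex at h; split_ifs at h with h'
  · exact absurd h.symm hw
  · exact h

lemma contractLink_isLink {f : β} {a b : α} : (G.contractLink e x y).IsLink f a b ↔
    f ≠ e ∧ ∃ a' b', G.IsLink f a' b' ∧ mergeVertex x y a' = a ∧ mergeVertex x y b' = b := by
  simp only [contractLink, map_isLink, Relation.Map, deleteEdges_isLink, Set.mem_singleton_iff]
  constructor
  · rintro ⟨a', b', ⟨h, hf⟩, h₁, h₂⟩
    exact ⟨hf, a', b', h, h₁, h₂⟩
  · rintro ⟨hf, a', b', h, h₁, h₂⟩
    exact ⟨a', b', ⟨h, hf⟩, h₁, h₂⟩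

lemma mem_edgeSet_contractLink {f : β} :
    f ∈ E(G.contractLink e x y) ↔ f ∈ E(G) ∧ f ≠ e := by
  simp [contractLink]

lemma endSet_contractLink (he : e ∉ C) :
    (G.contractLink e x y).endSet C = mergeVertex x y '' G.endSet C := by
  ext z
  constructor
  · rintro ⟨f, hf, w, hl⟩
    obtain ⟨-, a, b, hab, rfl, -⟩ := contractLink_isLink.1 hl
    exact ⟨a, ⟨f, hf, hab.inc_left⟩, rfl⟩
  · rintro ⟨a, ⟨f, hf, b, hab⟩, rfl⟩
    exact ⟨f, hf, _, contractLink_isLink.2 ⟨fun h ↦ he (h ▸ hf), a, b, hab, rfl, rfl⟩⟩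

lemma IsCycle.notMem_of_contractLink (h : (G.contractLink e x y).IsCycle C) : e ∉ C :=
  fun he ↦ (mem_edgeSet_contractLink.1 (h.subset_edgeSet he)).2 rfl

/-- A cycle through both ends of `e` is not a cycle after the contraction of `e`. -/
lemma IsCycle.not_mem_and_mem (h : (G.contractLink e x y).IsCycle C) (hC : G.IsCycle C)
    (hxy : x ≠ y) : ¬ (x ∈ G.endSet C ∧ y ∈ G.endSet C) := by
  rintro ⟨hx, hy⟩
  -- Merging two vertices of a cycle would leave fewer vertices than edges.
  have h₁ := h.ncard_endSet
  rw [endSet_contractLink h.notMem_of_contractLink, ← hC.ncard_endSet] at h₁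
  exact hxy ((Set.ncard_image_iff hC.finite_endSet).1 h₁ hx hy
    (by rw [mergeVertex_left, mergeVertex_right]))

/-- A path of the contraction that ends in the new vertex lifts to a path ending in one of the
ends of the contracted edge and avoiding the other. -/
lemma IsPath.exists_lift (h : (G.contractLink e x y).IsPath z L x) (hz : z ≠ x) :
    ∃ b M, (b = x ∨ b = y) ∧ G.IsPath z M b ∧ M.map Prod.fst = L.map Prod.fst ∧
      (M.map Prod.snd).map (mergeVertex x y) = L.map Prod.snd ∧
      ∀ w ∈ z :: M.map Prod.snd, w = x ∨ w = y → w = b := by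
  induction L generalizing z with
  | nil => exact absurd h.isWalk.2 hz
  | cons s L ih =>
    obtain ⟨f, w⟩ := s
    obtain ⟨hwalk, hnodup⟩ := h
    obtain ⟨-, a, b, hab, ha, hb⟩ := contractLink_isLink.1 hwalk.1
    have haz := eq_of_mergeVertex_eq ha hz
    subst haz
    have hay : a ≠ y := by
      rintro rfl
      rw [mergeVertex_right] at ha
      exact hz ha.symm
    have hn := List.nodup_cons.1 hnodup
    by_cases hw : w = x
    · subst hw
      have hL : L = [] := IsPath.eq_nil ⟨hwalk.2, hn.2⟩
      subst hL
      have hb' := mergeVertex_eq_left_iff.1 hb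
      refine ⟨b, [(f, b)], hb', ⟨⟨hab, hab.right_mem, rfl⟩, ?_⟩, rfl, by simp [hb], ?_⟩
      · rcases hb' with rfl | rfl <;> simp [hz, hay]
      · simp only [List.map_cons, List.map_nil, List.mem_cons, List.not_mem_nil, or_false]
        rintro v (rfl | rfl) hv
        · rcases hv with rfl | rfl
          · exact absurd rfl hz
          · exact absurd rfl hay
        · rfl
    · have hbw := eq_of_mergeVertex_eq hb hw
      subst hbw
      obtain ⟨c, M, hc, hM, hMf, hMs, hMw⟩ := ih ⟨hwalk.2, hn.2⟩ hw
      refine ⟨c, (f, b) :: M, hc, ⟨⟨hab, hM.isWalk⟩, ?_⟩, by simp [hMf], by simp [← hMs, hb], ?_⟩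
      · rw [List.map_cons, List.nodup_cons]
        refine ⟨fun hmem ↦ ?_, hM.vertices_nodup⟩
        refine hn.1 ?_
        have := List.mem_map_of_mem (f := mergeVertex x y) hmem
        rwa [ha, List.map_cons, hMs, hb] at this
      · intro v hv
        rcases List.mem_cons.1 hv with rfl | hv
        · rintro (rfl | rfl)
          · exact absurd rfl hz
          · exact absurd rfl hay
        · exact hMw v hv

/-- A cycle of the contraction of `e` arises from a cycle, possibly through `e`. -/
lemma IsCycle.of_contractLink (h : (G.contractLink e x y).IsCycle C) (he : G.IsLink e x y)
    (hxy : x ≠ y) : G.IsCycle C ∨ G.IsCycle (insert e C) := by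
  have heC := h.notMem_of_contractLink
  obtain ⟨w, L, h, rfl⟩ := h
  -- A cycle that misses the merged vertex is untouched by the contraction; otherwise it is cut open
  -- at that vertex and lifted.
  by_cases hx : x ∈ L.map Prod.snd
  swap
  · left
    have hw : w ∈ L.map Prod.snd := h.isWalk.right_mem_vertices h.ne_nil
    have hne : ∀ v ∈ w :: L.map Prod.snd, v ≠ x := by
      rintro v hv rfl
      rcases List.mem_cons.1 hv with rfl | hv <;> exact hx ‹_›
    refine ⟨w, L, ⟨h.isWalk.mono ?_ ?_, h.ne_nil, h.edges_nodup, h.vertices_nodup⟩, rfl⟩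
    · rintro ⟨w', hw', hm⟩
      rwa [← eq_of_mergeVertex_eq hm (hne w (by simp))]
    · intro f _ a b ha hb hl
      obtain ⟨-, a', b', hab, ha', hb'⟩ := contractLink_isLink.1 hl
      rwa [← eq_of_mergeVertex_eq ha' (hne a ha), ← eq_of_mergeVertex_eq hb' (hne b hb)]
  obtain ⟨L', h', hL'⟩ := h.exists_rotate hx
  rw [← hL'] at heC ⊢
  clear hL' hx h L w
  cases L' with
  | nil => exact absurd rfl h'.ne_nil
  | cons s L =>
    obtain ⟨f, z⟩ := s
    obtain ⟨-, a, c, hac, ha, hc⟩ := contractLink_isLink.1 h'.isWalk.1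
    rw [mergeVertex_eq_left_iff] at ha
    have hp : (G.contractLink e x y).IsPath z L x := ⟨h'.isWalk.2, h'.vertices_nodup⟩
    obtain ⟨b, M, hb, hM, hMf, hMw⟩ : ∃ b M, (b = x ∨ b = y) ∧ G.IsPath c M b ∧
        M.map Prod.fst = L.map Prod.fst ∧ ∀ w ∈ c :: M.map Prod.snd, w = x ∨ w = y → w = b := by
      by_cases hz : z = x
      · subst hz
        obtain rfl := hp.eq_nil
        rw [mergeVertex_eq_left_iff] at hc
        exact ⟨c, [], hc, ⟨⟨hac.right_mem, rfl⟩, by simp⟩, rfl, by simp⟩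
      · obtain rfl := eq_of_mergeVertex_eq hc hz
        obtain ⟨b, M, hb, hM, hMf, -, hMw⟩ := hp.exists_lift hz
        exact ⟨b, M, hb, hM, hMf, hMw⟩
    have hedges : stepEdges ((f, c) :: M) = stepEdges ((f, z) :: L) := by
      ext; simp [stepEdges, hMf]
    have hnodup : (((f, c) :: M).map Prod.fst).Nodup := by
      simpa [hMf] using h'.edges_nodup
    -- The lifted walk leaves from `a` and ends in `b`, both ends of `e`: either it closes up by
    -- itself, or `e` closes it.
    by_cases hab : a = b
    · subst hab
      exact Or.inl ⟨a, (f, c) :: M, ⟨⟨hac, hM.isWalk⟩, by simp, hnodup, hM.vertices_nodup⟩,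
        hedges⟩
    · refine Or.inr ⟨b, (e, a) :: (f, c) :: M, ⟨⟨?_, hac, hM.isWalk⟩, by simp, ?_, ?_⟩, ?_⟩
      · rcases ha with rfl | rfl <;> rcases hb with rfl | rfl
        · exact absurd rfl hab
        · exact he.symm
        · exact he
        · exact absurd rfl hab
      · rw [List.map_cons, List.nodup_cons]
        refine ⟨fun hmem ↦ heC ?_, hnodup⟩
        rw [← hedges]
        exact hmem
      · rw [List.map_cons, List.nodup_cons]
        exact ⟨fun hmem ↦ hab (hMw a hmem ha), hM.vertices_nodup⟩
      · rw [stepEdges_cons, hedges]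

end Graph

/-! ### Labellability passes to minors -/

namespace MarkedGraph

open Graph

variable {α β : Type*} {Ω : MarkedGraph α β} {x y z : α} {e : β} {C : Set β}
  {Γ : Type*} [Group Γ]

lemma Labellable.delete (h : Ω.Labellable Γ) (e : β) : (Ω.delete e).Labellable Γ := by
  obtain ⟨φ, hφ⟩ := h
  let ψ : (Ω.delete e).graph.GroupLabelling Γ :=
    { tail := φ.tail
      head := φ.head
      label := φ.label
      isLink := fun f hf ↦ by
        simp only [MarkedGraph.delete, edgeSet_deleteEdges, Set.mem_sdiff] at hf
        simpa [MarkedGraph.delete] using ⟨φ.isLink f hf.1, hf.2⟩ }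
  refine ⟨ψ, ?_⟩
  ext C
  rw [ψ.mem_balancedCycles_iff]
  change (Ω.graph.deleteEdges {e}).IsCycle C ∧ _ ↔ C ∈ Ω.balanced ∧ e ∉ C
  rw [← hφ, φ.mem_balancedCycles_iff, isCycle_deleteEdges]
  constructor
  · rintro ⟨⟨h₁, h₂⟩, h₃⟩
    exact ⟨⟨h₁, h₃⟩, h₂⟩
  · rintro ⟨⟨h₁, h₃⟩, h₂⟩
    exact ⟨⟨h₁, h₂⟩, h₃⟩

lemma Labellable.contractLink (h : Ω.Labellable Γ) (he : Ω.graph.IsLink e x y) (hxy : x ≠ y) :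
    (Ω.contractLink e x y).Labellable Γ := by
  classical
  obtain ⟨φ, hφ⟩ := h
  have hends := (φ.isLink e he.edge_mem).eq_and_eq_or_eq_and_eq he
  -- Switching by `s` makes the label of `e` trivial, after which its ends can be identified.
  obtain ⟨s, hs⟩ : ∃ s : α → Γ, s (φ.tail e) * φ.label e = s (φ.head e) := by
    refine ⟨Function.update 1 (φ.head e) (φ.label e), ?_⟩
    have : φ.tail e ≠ φ.head e := by
      rcases hends with ⟨h₁, h₂⟩ | ⟨h₁, h₂⟩ <;> rw [h₁, h₂]
      exacts [hxy, hxy.symm]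
    rw [Function.update_of_ne this]
    simp
  let ψ : (Ω.contractLink e x y).graph.GroupLabelling Γ :=
    { tail := fun f ↦ mergeVertex x y (φ.tail f)
      head := fun f ↦ mergeVertex x y (φ.head f)
      label := fun f ↦ s (φ.tail f) * φ.label f * (s (φ.head f))⁻¹
      isLink := fun f hf ↦ by
        obtain ⟨hf, hfe⟩ := mem_edgeSet_contractLink.1 hf
        exact contractLink_isLink.2 ⟨hfe, _, _, φ.isLink f hf, rfl, rfl⟩ }
  have key : ∀ C, (∃ p, ψ.IsPotential C p) ↔ ∃ p, φ.IsPotential (insert e C) p := by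
    intro C
    constructor
    · rintro ⟨p, hp⟩
      refine ⟨fun v ↦ p (mergeVertex x y v) * s v, ?_⟩
      rintro f (rfl | hf)
      · have : p (mergeVertex x y (φ.tail f)) = p (mergeVertex x y (φ.head f)) := by
          rcases hends with ⟨h₁, h₂⟩ | ⟨h₁, h₂⟩ <;> rw [h₁, h₂, mergeVertex_left, mergeVertex_right]
        rw [mul_assoc, hs, this]
      · have := hp f hf
        change p (mergeVertex x y (φ.tail f)) * (s (φ.tail f) * φ.label f * (s (φ.head f))⁻¹) =
          p (mergeVertex x y (φ.head f)) at this
        beta_reduce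
        rw [← this]
        group
    · rintro ⟨p, hp⟩
      have hpe : p (φ.tail e) * (s (φ.tail e))⁻¹ = p (φ.head e) * (s (φ.head e))⁻¹ := by
        rw [← hs, ← hp e (Set.mem_insert _ _)]
        group
      have hpxy : p x * (s x)⁻¹ = p y * (s y)⁻¹ := by
        rcases hends with ⟨h₁, h₂⟩ | ⟨h₁, h₂⟩ <;> rw [h₁, h₂] at hpe
        exacts [hpe, hpe.symm]
      have hm : ∀ v, p (mergeVertex x y v) * (s (mergeVertex x y v))⁻¹ = p v * (s v)⁻¹ := by
        intro v
        by_cases hv : v = y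
        · rw [hv, mergeVertex_right, hpxy]
        · rw [mergeVertex_of_ne hv]
      refine ⟨fun v ↦ p v * (s v)⁻¹, fun f hf ↦ ?_⟩
      change p (mergeVertex x y (φ.tail f)) * (s (mergeVertex x y (φ.tail f)))⁻¹ *
        (s (φ.tail f) * φ.label f * (s (φ.head f))⁻¹) =
          p (mergeVertex x y (φ.head f)) * (s (mergeVertex x y (φ.head f)))⁻¹
      rw [hm, hm, ← hp f (Set.mem_insert_of_mem _ hf)]
      group
  refine ⟨ψ, ?_⟩
  ext C
  rw [ψ.mem_balancedCycles_iff, key]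
  change (Ω.graph.contractLink e x y).IsCycle C ∧ _ ↔
    (Ω.graph.contractLink e x y).IsCycle C ∧ (C ∈ Ω.balanced ∨ C ∪ {e} ∈ Ω.balanced)
  refine and_congr_right fun hC ↦ ?_
  rw [Set.union_singleton, ← hφ, φ.mem_balancedCycles_iff, φ.mem_balancedCycles_iff]
  constructor
  · rintro ⟨p, hp⟩
    rcases hC.of_contractLink he hxy with h | h
    · exact Or.inl ⟨h, p, fun f hf ↦ hp f (Set.mem_insert_of_mem _ hf)⟩
    · exact Or.inr ⟨h, p, hp⟩
  · rintro (⟨h, p, hp⟩ | ⟨-, hp⟩)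
    swap
    · exact hp
    -- A balanced cycle avoiding `e` misses an end of `e`, so the value there is free and the
    -- potential extends over `e`.
    have hpair := hC.not_mem_and_mem h hxy
    have extend : ∀ u v, Ω.graph.IsLink e u v → u ≠ v → u ∉ Ω.graph.endSet C →
        ∃ p, φ.IsPotential (insert e C) p := by
      intro u v huv hne hu
      refine ⟨Function.update p u
        (p v * (if φ.tail e = v then φ.label e else (φ.label e)⁻¹)), ?_⟩
      rintro f (rfl | hf)
      · refine GroupLabelling.isPotential_of_step huv.symm ?_
        rw [Function.update_of_ne hne.symm, Function.update_self]
      · refine hp.congr h.subset_edgeSet (fun w hw ↦ ?_) f hf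
        rw [Function.update_of_ne]
        rintro rfl
        exact hu hw
    by_cases hx : x ∈ Ω.graph.endSet C
    · exact extend y x he.symm hxy.symm fun hy ↦ hpair ⟨hx, hy⟩
    · exact extend x y he hxy hx

lemma Labellable.contractLoop_lift (h : Ω.Labellable Γ) (e : β) (x : α) :
    (Ω.contractLoop e x .lift).Labellable Γ := by
  obtain ⟨φ, hφ⟩ := h
  let ψ : (Ω.contractLoop e x .lift).graph.GroupLabelling Γ :=
    { tail := φ.tail
      head := φ.head
      label := fun _ ↦ 1
      isLink := fun f hf ↦ by
        simp only [MarkedGraph.contractLoop, edgeSet_deleteEdges, Set.mem_sdiff] at hf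
        simpa [MarkedGraph.contractLoop] using ⟨φ.isLink f hf.1, hf.2⟩ }
  refine ⟨ψ, ?_⟩
  ext C
  rw [ψ.mem_balancedCycles_iff]
  exact ⟨fun h ↦ h.1, fun h ↦ ⟨h, fun _ ↦ 1, fun f _ ↦ one_mul _⟩⟩

/-- Former links at `x` become loops and need a label different from 1, loops at `x` get label 1,
and the other labels stay. -/
lemma Labellable.contractLoop_frame [Nontrivial Γ] (h : Ω.Labellable Γ)
    (he : Ω.graph.IsLoopAt e x) : (Ω.contractLoop e x .frame).Labellable Γ := by
  classical
  obtain ⟨φ, hφ⟩ := h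
  obtain ⟨g, hg⟩ := exists_ne (1 : Γ)
  let ψ : (Ω.contractLoop e x .frame).graph.GroupLabelling Γ :=
    { tail := fun f ↦ if φ.tail f = x then φ.head f else φ.tail f
      head := fun f ↦ if φ.head f = x then φ.tail f else φ.head f
      label := fun f ↦ if Ω.graph.IsLoopAt f x then 1 else if Ω.graph.Inc f x then g else φ.label f
      isLink := fun f hf ↦ by
        obtain ⟨a, b, hfe, hab⟩ := ((Graph.edge_mem_iff_exists_isLink _ _).1 hf)
        have hfG : f ∈ E(Ω.graph) := by
          rcases hab with ⟨h, -⟩ | ⟨h, -⟩ | ⟨h, -⟩ <;> exact h.edge_mem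
        have hl := φ.isLink f hfG
        refine ⟨hfe, ?_⟩
        by_cases h₁ : φ.tail f = x <;> by_cases h₂ : φ.head f = x
        · rw [h₁, h₂] at hl
          simpa [h₁, h₂] using hl
        · rw [h₁] at hl
          simpa [h₁, h₂] using Or.inr hl
        · rw [h₂] at hl
          simpa [h₁, h₂] using Or.inr hl.symm
        · simpa [h₁, h₂] using Or.inl hl }
  refine ⟨ψ, ?_⟩
  ext C
  rw [ψ.mem_balancedCycles_iff]
  change (Ω.graph.contractLoopFrame e x).IsCycle C ∧ _ ↔
    ((C ∈ Ω.balanced ∧ ∀ f ∈ C, ¬ Ω.graph.Inc f x) ∨ ∃ f, f ≠ e ∧ Ω.graph.IsLoopAt f x ∧ C = {f})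
  rw [← hφ, φ.mem_balancedCycles_iff]
  have hpot : (∀ f ∈ C, ¬ Ω.graph.Inc f x) → C ⊆ E(Ω.graph) →
      ∀ p, ψ.IsPotential C p ↔ φ.IsPotential C p := by
    intro hC hCE p
    refine forall₂_congr fun f hf ↦ ?_
    have hl := φ.isLink f (hCE hf)
    have h₁ : φ.tail f ≠ x := fun h ↦ hC f hf (h ▸ hl.inc_left)
    have h₂ : φ.head f ≠ x := fun h ↦ hC f hf (h ▸ hl.inc_right)
    have h₃ : ¬ Ω.graph.IsLoopAt f x := fun h ↦ hC f hf h.inc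
    simp [ψ, h₁, h₂, h₃, hC f hf]
  constructor
  · rintro ⟨hC, p, hp⟩
    by_cases hx : ∃ f ∈ C, Ω.graph.Inc f x
    · right
      obtain ⟨f, hf, w, hw⟩ := hx
      obtain ⟨a, b, hfe, hab⟩ := ((Graph.edge_mem_iff_exists_isLink _ _).1 (hC.subset_edgeSet hf))
      have hwx : w = x := by
        by_contra hwx
        have hn : ¬ Ω.graph.IsLoopAt f x := fun h ↦ hwx (h.eq_of_inc hw.inc_right).symm
        have := hp f hf
        rcases (φ.isLink f hw.edge_mem).eq_and_eq_or_eq_and_eq hw with ⟨h₁, h₂⟩ | ⟨h₁, h₂⟩ <;>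
          simp [ψ, h₁, h₂, hwx, hn, hw.inc_left, hg] at this
      subst hwx
      exact ⟨f, hfe, hw, hC.eq_singleton hf (x := w) ⟨hfe, Or.inr (Or.inl ⟨hw, rfl, rfl⟩)⟩⟩
    · left
      push Not at hx
      have hCG : Ω.graph.IsCycle C := by
        refine hC.mono subset_rfl fun f hf a b hab ↦ ?_
        rcases hab with ⟨-, ⟨h, -⟩ | ⟨h, -⟩ | ⟨h, -⟩⟩
        · exact h
        · exact absurd h.inc (hx f hf)
        · exact absurd h.inc_left (hx f hf)
      exact ⟨⟨hCG, p, (hpot hx hCG.subset_edgeSet p).1 hp⟩, hx⟩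
  · rintro (⟨⟨hC, p, hp⟩, hx⟩ | ⟨f, hfe, hf, rfl⟩)
    · refine ⟨hC.mono subset_rfl fun f hf a b hab ↦ ⟨?_, Or.inl ⟨hab, ?_, ?_⟩⟩, p,
        (hpot hx hC.subset_edgeSet p).2 hp⟩
      · rintro rfl
        exact hx f hf he.inc
      · rintro rfl
        exact hx f hf hab.inc_left
      · rintro rfl
        exact hx f hf hab.inc_right
    · refine ⟨IsLoopAt.isCycle (x := x) ⟨hfe, Or.inr (Or.inl ⟨hf, rfl, rfl⟩)⟩, fun _ ↦ 1, ?_⟩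
      rintro _ rfl
      simp [ψ, hf]

/-- Labellability over a nontrivial group is inherited by minors. -/
lemma Labellable.isStep [Nontrivial Γ] {r : LoopRule} {Ω' : MarkedGraph α β}
    (h : Ω.Labellable Γ) (hs : IsStep r Ω Ω') : Ω'.Labellable Γ := by
  cases hs with
  | delete he => exact h.delete _
  | contractLink he hxy => exact h.contractLink he hxy
  | contractBalancedLoop he hb => exact h.delete _
  | contractUnbalancedLoop he hb =>
    cases r with
    | lift => exact h.contractLoop_lift _ _
    | frame => exact h.contractLoop_frame he

lemma HasProperMinor.labellable [Nontrivial Γ] {r : LoopRule} {Ω' : MarkedGraph α β}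
    (h : HasProperMinor r Ω Ω') (hs : ∀ Ω₁, IsStep r Ω Ω₁ → Ω₁.Labellable Γ) :
    Ω'.Labellable Γ := by
  induction h with
  | single h => exact hs _ h
  | tail _ h ih => exact ih.isStep h

end MarkedGraph

/-! ### Generic choices in an infinite group -/

/-- In an infinite group, finitely many conditions, each of which for some coordinate `i` is
violated by at most one value of `x i` once the other coordinates are given, can be met
simultaneously. -/
theorem exists_forall_not_of_update {ι σ Γ : Type*} [Finite ι] [Finite σ] [Infinite Γ]
    [DecidableEq ι] (P : σ → (ι → Γ) → Prop)
    (hP : ∀ s, ∃ i, ∀ x g, P s x → P s (Function.update x i g) → g = x i) :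
    ∃ x, ∀ s, ¬ P s x := by
  classical
  have := Fintype.ofFinite ι
  have := Fintype.ofFinite σ
  by_contra! h
  choose i hi using hP
  choose s hs using h
  -- If every point of the grid `ι → A` were bad, it would be determined by a bad event `t` and its
  -- coordinates off `i t`. That allows at most `card σ / card A` of the grid, too few when `A` has
  -- one element more than `σ`.
  obtain ⟨A, hA⟩ := Infinite.exists_subset_card_eq Γ (Fintype.card σ + 1)
  let F : (ι → A) → Σ t : σ, ({j // j ≠ i t} → A) := fun x ↦ ⟨s fun j ↦ x j, fun j ↦ x j⟩
  have hF : Function.Injective F := by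
    intro x y hxy
    simp only [F, Sigma.mk.injEq] at hxy
    obtain ⟨hst, hr⟩ := hxy
    have hx := hs fun j ↦ (x j : Γ)
    have hy := hs fun j ↦ (y j : Γ)
    rw [← hst] at hy
    generalize s (fun j ↦ (x j : Γ)) = t at hx hy hr hst
    generalize s (fun j ↦ (y j : Γ)) = t' at hr hst
    subst hst
    have hoff : ∀ j, j ≠ i t → x j = y j := fun j hj ↦ congrFun (eq_of_heq hr) ⟨j, hj⟩
    have hup : (fun j ↦ (y j : Γ)) = Function.update (fun j ↦ (x j : Γ)) (i t) (y (i t)) := by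
      ext j
      by_cases hj : j = i t
      · subst hj; simp
      · rw [Function.update_of_ne hj, hoff j hj]
    rw [hup] at hy
    have hval := hi t _ _ hx hy
    ext j
    by_cases hj : j = i t
    · subst hj; exact hval.symm
    · rw [hoff j hj]
  have hcard := Fintype.card_le_of_injective F hF
  rw [Fintype.card_sigma] at hcard
  have hsplit : ∀ t : σ, (Fintype.card σ + 1) * Fintype.card ({j // j ≠ i t} → A) =
      Fintype.card (ι → A) := by
    intro t
    rw [Fintype.card_congr (Equiv.funSplitAt (i t) A), Fintype.card_prod, Fintype.card_coe, hA]
  have h₁ := Nat.mul_le_mul_left (Fintype.card σ + 1) hcard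
  rw [Finset.mul_sum, Finset.sum_congr rfl fun t _ ↦ hsplit t, Finset.sum_const, Finset.card_univ,
    smul_eq_mul] at h₁
  have h₂ : 0 < Fintype.card (ι → A) := by
    rw [Fintype.card_fun, Fintype.card_coe, hA]
    positivity
  have h₃ := Nat.le_of_mul_le_mul_right h₁ h₂
  omega

/-! ### The bipyramid and its faces -/

namespace Bipyramid

variable {n : ℕ} {Γ : Type*} [Group Γ]

/-- Indices of the `2 * (n + 2)` edges in a parallel class. -/
abbrev Index (n : ℕ) := Bool × Fin (n + 2)

/-- The end of a rim edge among the vertices of the first colour. -/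
def shift (d : Index n) : Fin (n + 2) := if d.1 then d.2 + 1 else d.2

/-- The faces of the bipyramid over a cycle of length `2 * (n + 2)`, given by an apex and a rim
edge, read as sequences of edges. The rim edges are subdivided, so that coordinates from `2` on
all give the rim edge. -/
def face (s : Bool × Index n) : ℕ → Index n
  | 0 => (s.1, s.2.2)
  | 1 => (s.1, shift s.2)
  | _ + 2 => s.2

/-- The one face that is declared unbalanced. -/
def hole (n : ℕ) : Bool × Index n := (true, false, 0)

@[simp] lemma face_zero (s : Bool × Index n) : face s 0 = (s.1, s.2.2) := rfl

@[simp] lemma face_one (s : Bool × Index n) : face s 1 = (s.1, shift s.2) := rfl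

lemma face_of_two_le (s : Bool × Index n) {i : ℕ} (hi : 2 ≤ i) : face s i = s.2 := by
  obtain ⟨i, rfl⟩ := Nat.exists_eq_add_of_le' hi
  rfl

@[simp] lemma face_two (s : Bool × Index n) : face s 2 = s.2 := rfl

/-- The two rim edges at a vertex of the second colour have different other ends, since `j + 1 ≠ j`
in `Fin (n + 2)`. -/
lemma shift_injective {d d' : Index n} (h : d.2 = d'.2) (hs : shift d = shift d') : d = d' := by
  obtain ⟨b, j⟩ := d
  obtain ⟨b', j'⟩ := d'
  obtain rfl : j = j' := h
  cases b <;> cases b' <;> simp_all [shift]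

/-- Distinct faces agree in at most one of the first three coordinates. -/
lemma face_eq_of_two {s s' : Bool × Index n} {i j : ℕ} (hi : i < 3) (hj : j < 3) (hij : i ≠ j)
    (h₁ : face s i = face s' i) (h₂ : face s j = face s' j) : s = s' := by
  obtain ⟨e, d⟩ := s
  obtain ⟨e', d'⟩ := s'
  interval_cases i <;> interval_cases j <;> simp_all [Prod.ext_iff (x := d)]
  · exact congrArg Prod.fst (shift_injective h₁.2 h₂)
  · exact congrArg Prod.fst (shift_injective h₂ h₁.2)

/-! ### Realizing sets of triangles by labels -/

/-- The triples of edges, one from each of three parallel classes, that satisfy `T` are exactly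
those with product `1` for some labelling by `Γ` with distinct labels in each class. -/
def Realizable₃ (Γ : Type*) [Group Γ] {D : Type*} (T : D → D → D → Prop) : Prop :=
  ∃ a b c : D → Γ, a.Injective ∧ b.Injective ∧ c.Injective ∧
    ∀ x y z, a x * b y * c z = 1 ↔ T x y z

lemma Realizable₃.congr {D : Type*} {T T' : D → D → D → Prop} (h : Realizable₃ Γ T)
    (hT : ∀ x y z, T x y z ↔ T' x y z) : Realizable₃ Γ T' := by
  obtain ⟨a, b, c, ha, hb, hc, h⟩ := h
  exact ⟨a, b, c, ha, hb, hc, fun x y z ↦ (h x y z).trans (hT x y z)⟩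

/-- A product equal to 1 stays so under cyclic rotation; this brings any class into the third place.
-/
lemma Realizable₃.rotate {D : Type*} {T : D → D → D → Prop} (h : Realizable₃ Γ T) :
    Realizable₃ Γ fun x y z ↦ T z x y := by
  obtain ⟨a, b, c, ha, hb, hc, h⟩ := h
  refine ⟨b, c, a, hb, hc, ha, fun x y z ↦ ?_⟩
  beta_reduce
  rw [← h, mul_assoc (a z), mul_eq_one_iff_eq_inv, mul_eq_one_iff_inv_eq, eq_comm]

/-- Giving an edge a generic label destroys exactly the relations through it. -/
lemma Realizable₃.avoid_third [Infinite Γ] {D : Type*} [Finite D] {T : D → D → D → Prop}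
    (h : Realizable₃ Γ T) (d : D) : Realizable₃ Γ fun x y z ↦ T x y z ∧ z ≠ d := by
  classical
  obtain ⟨a, b, c, ha, hb, hc, h⟩ := h
  obtain ⟨g, hg⟩ := ((Set.finite_range c).union
    (Set.finite_range fun x : D × D ↦ (a x.1 * b x.2)⁻¹)).exists_notMem
  simp only [Set.mem_union, Set.mem_range, Prod.exists, not_or, not_exists] at hg
  refine ⟨a, b, Function.update c d g, ha, hb, ?_, fun x y z ↦ ?_⟩
  · intro z z' hz
    by_cases h₁ : z = d <;> by_cases h₂ : z' = d <;> simp [h₁, h₂] at hz ⊢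
    · exact absurd hz.symm (hg.1 _)
    · exact absurd hz (hg.1 _)
    · exact hc hz
  · by_cases hz : z = d
    · subst hz
      simp only [Function.update_self, ne_eq, not_true_eq_false, and_false, iff_false]
      intro h'
      exact hg.2 x y (eq_inv_of_mul_eq_one_right h').symm
    · simp [hz, h]

/-- The face relation in the first three coordinates. -/
def IsFace (K : Set (Bool × Index n)) (x y z : Index n) : Prop :=
  ∃ s ∈ K, x = face s 0 ∧ y = face s 1 ∧ z = face s 2

lemma Realizable₃.avoid [Infinite Γ] {K : Set (Bool × Index n)} (h : Realizable₃ Γ (IsFace K))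
    {i : ℕ} (hi : i < 3) (d : Index n) : Realizable₃ Γ (IsFace {s ∈ K | face s i ≠ d}) := by
  interval_cases i
  · refine ((h.rotate.avoid_third d).rotate.rotate).congr fun x y z ↦ ?_
    constructor
    · rintro ⟨⟨s, hs, rfl, rfl, rfl⟩, hx⟩
      exact ⟨s, ⟨hs, hx⟩, rfl, rfl, rfl⟩
    · rintro ⟨s, ⟨hs, hx⟩, rfl, rfl, rfl⟩
      exact ⟨⟨s, hs, rfl, rfl, rfl⟩, hx⟩
  · refine ((h.rotate.rotate.avoid_third d).rotate).congr fun x y z ↦ ?_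
    constructor
    · rintro ⟨⟨s, hs, rfl, rfl, rfl⟩, hx⟩
      exact ⟨s, ⟨hs, hx⟩, rfl, rfl, rfl⟩
    · rintro ⟨s, ⟨hs, hx⟩, rfl, rfl, rfl⟩
      exact ⟨⟨s, hs, rfl, rfl, rfl⟩, hx⟩
  · refine (h.avoid_third d).congr fun x y z ↦ ?_
    constructor
    · rintro ⟨⟨s, hs, rfl, rfl, rfl⟩, hx⟩
      exact ⟨s, ⟨hs, hx⟩, rfl, rfl, rfl⟩
    · rintro ⟨s, ⟨hs, hx⟩, rfl, rfl, rfl⟩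
      exact ⟨⟨s, hs, rfl, rfl, rfl⟩, hx⟩

lemma Realizable₃.avoid_finset [Infinite Γ] {K : Set (Bool × Index n)}
    (h : Realizable₃ Γ (IsFace K)) {i : ℕ} (hi : i < 3) (X : Finset (Index n)) :
    Realizable₃ Γ (IsFace {s ∈ K | face s i ∉ X}) := by
  induction X using Finset.induction_on with
  | empty => simpa using h
  | insert d X _ ih =>
    convert ih.avoid hi d using 2
    ext s
    simp only [Finset.mem_insert, not_or, Set.mem_ofPred_eq]
    tauto

/-! ### Labels from rim potentials -/

/-- Labels of the bipyramid obtained from generic potentials on the rim. The functions `P` and `Q`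
describe the apices, `g` a correction on the rim edges. -/
lemma realizable₃_of_potential [Infinite Γ] (P Q g : Index n → Γ)
    (hP : ∀ b b' j, P (b, j) = P (b', j) → b = b') (hQ : ∀ b b' j, Q (b, j) = Q (b', j) → b = b')
    (hPQ : ∀ b b' d, P (b, shift d) * g d = Q (b', d.2) → b = b') :
    Realizable₃ Γ (IsFace {s | P (s.1, shift s.2) * g s.2 = Q (s.1, s.2.2)}) := by
  -- `x` and `y` are potentials on the first and second rim colour. They are chosen in this order
  -- because the conditions on `y` involve `x`. Each excludes a coincidence of labels, or a relation
  -- among edges that do not meet as in a face.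
  obtain ⟨x, hx⟩ := exists_forall_not_of_update
    (σ := (Index n × Index n) ⊕ (Index n × Index n) ⊕ (Index n × Index n × Index n))
    (ι := Fin (n + 2)) (Γ := Γ)
    (fun s x ↦ match s with
      | .inl (d, d') => d.2 ≠ d'.2 ∧ P d * x d.2 = P d' * x d'.2
      | .inr (.inl (d, d')) => shift d ≠ shift d' ∧ (x (shift d))⁻¹ * g d = (x (shift d'))⁻¹ * g d'
      | .inr (.inr (b, a, d)) => a.2 ≠ shift d ∧ P a * x a.2 * (x (shift d))⁻¹ * g d = Q b)
    (by
      rintro (⟨d, d'⟩ | ⟨d, d'⟩ | ⟨b, a, d⟩)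
      · refine ⟨d.2, fun x g ⟨h, h₁⟩ ⟨_, h₂⟩ ↦ ?_⟩
        rw [Function.update_self, Function.update_of_ne h.symm, ← h₁] at h₂
        exact mul_left_cancel h₂
      · refine ⟨shift d, fun x g ⟨h, h₁⟩ ⟨_, h₂⟩ ↦ ?_⟩
        rw [Function.update_self, Function.update_of_ne h.symm, ← h₁] at h₂
        exact inv_injective (mul_right_cancel h₂)
      · refine ⟨a.2, fun x g ⟨h, h₁⟩ ⟨_, h₂⟩ ↦ ?_⟩
        rw [Function.update_self, Function.update_of_ne h.symm, ← h₁] at h₂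
        exact mul_left_cancel (mul_right_cancel (mul_right_cancel h₂)))
  obtain ⟨y, hy⟩ := exists_forall_not_of_update
    (σ := (Index n × Index n) ⊕ (Index n × Index n) ⊕ (Index n × Index n × Index n))
    (ι := Fin (n + 2)) (Γ := Γ)
    (fun s y ↦ match s with
      | .inl (d, d') => d.2 ≠ d'.2 ∧ Q d * y d.2 = Q d' * y d'.2
      | .inr (.inl (d, d')) => d.2 ≠ d'.2 ∧
          (x (shift d))⁻¹ * g d * y d.2 = (x (shift d'))⁻¹ * g d' * y d'.2
      | .inr (.inr (b, a, d)) => b.2 ≠ d.2 ∧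
          P a * x a.2 * ((x (shift d))⁻¹ * g d * y d.2) = Q b * y b.2)
    (by
      rintro (⟨d, d'⟩ | ⟨d, d'⟩ | ⟨b, a, d⟩)
      · refine ⟨d.2, fun x g ⟨h, h₁⟩ ⟨_, h₂⟩ ↦ ?_⟩
        rw [Function.update_self, Function.update_of_ne h.symm, ← h₁] at h₂
        exact mul_left_cancel h₂
      · refine ⟨d.2, fun x g ⟨h, h₁⟩ ⟨_, h₂⟩ ↦ ?_⟩
        rw [Function.update_self, Function.update_of_ne h.symm, ← h₁] at h₂
        exact mul_left_cancel h₂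
      · refine ⟨b.2, fun x g ⟨h, h₁⟩ ⟨_, h₂⟩ ↦ ?_⟩
        rw [Function.update_self, Function.update_of_ne h.symm, h₁] at h₂
        exact (mul_left_cancel h₂).symm)
  -- On a face the factors `x` cancel, leaving a conjugate by `y` of `Q⁻¹ * P * g`.
  refine ⟨fun d ↦ (Q d * y d.2)⁻¹, fun d ↦ P d * x d.2,
    fun d ↦ (x (shift d))⁻¹ * g d * y d.2, ?_, ?_, ?_, ?_⟩
  · intro d d' h
    have h := inv_injective h
    have h₂ : d.2 = d'.2 := by
      by_contra hd
      exact hy (.inl (d, d')) ⟨hd, h⟩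
    obtain ⟨b, j⟩ := d
    obtain ⟨b', j'⟩ := d'
    obtain rfl : j = j' := h₂
    rw [hQ b b' j (mul_right_cancel h)]
  · intro d d' h
    have h₂ : d.2 = d'.2 := by
      by_contra hd
      exact hx (.inl (d, d')) ⟨hd, h⟩
    obtain ⟨b, j⟩ := d
    obtain ⟨b', j'⟩ := d'
    obtain rfl : j = j' := h₂
    rw [hP b b' j (mul_right_cancel h)]
  · intro d d' h
    have h₂ : d.2 = d'.2 := by
      by_contra hd
      exact hy (.inr (.inl (d, d'))) ⟨hd, h⟩
    have h₁ : shift d = shift d' := by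
      by_contra hd
      beta_reduce at h
      rw [h₂] at h
      exact hx (.inr (.inl (d, d'))) ⟨hd, mul_right_cancel h⟩
    exact shift_injective h₂ h₁
  · intro b a d
    beta_reduce
    rw [mul_assoc, inv_mul_eq_one, eq_comm]
    constructor
    · intro h
      have h₁ : b.2 = d.2 := by
        by_contra hd
        exact hy (.inr (.inr (b, a, d))) ⟨hd, h⟩
      rw [h₁, ← mul_assoc, ← mul_assoc] at h
      have h := mul_right_cancel h
      have h₂ : a.2 = shift d := by
        by_contra hd
        exact hx (.inr (.inr (b, a, d))) ⟨hd, h⟩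
      rw [h₂, mul_inv_cancel_right] at h
      obtain ⟨a₁, a₂⟩ := a
      obtain ⟨b₁, b₂⟩ := b
      obtain rfl : a₂ = shift d := h₂
      obtain rfl : b₂ = d.2 := h₁
      obtain rfl := hPQ _ _ _ h
      exact ⟨(a₁, d), h, rfl, rfl, rfl⟩
    · rintro ⟨s, hs, rfl, rfl, rfl⟩
      have hs : P (s.1, shift s.2) * g s.2 = Q (s.1, s.2.2) := hs
      simp only [face_zero, face_one, face_two]
      rw [← hs]
      group

-- Apex values 1 and `h ≠ 1`, constant around the rim, balance every face while keeping parallel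
-- labels distinct.
variable (Γ) in
lemma realizable₃_univ [Infinite Γ] : Realizable₃ Γ (IsFace (Set.univ : Set (Bool × Index n))) := by
  obtain ⟨h, hh⟩ := exists_ne (1 : Γ)
  convert realizable₃_of_potential (n := n) (fun d ↦ if d.1 then h else 1)
    (fun d ↦ if d.1 then h else 1) (fun _ ↦ 1) ?_ ?_ ?_ using 2
  · simp
  all_goals
    intro b b' j
    cases b <;> cases b' <;> simp [hh, hh.symm]

variable (Γ) in
/-- Two faces of the bipyramid can be unbalanced while all the others are balanced. -/
lemma realizable₃_compl_pair [Infinite Γ] (e : Bool) (c : Index n) (hc : c ≠ (false, 0)) :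
    Realizable₃ Γ (IsFace {s : Bool × Index n | s ≠ hole n ∧ s ≠ (e, c)}) := by
  obtain ⟨h₁, hh₁⟩ := exists_ne (1 : Γ)
  -- Both values differ from 1, the value at the other apex, so that parallel labels stay distinct.
  obtain ⟨h₂, hh₂⟩ := ((Set.finite_singleton (1 : Γ)).insert h₁).exists_notMem
  simp only [Set.mem_insert_iff, Set.mem_singleton_iff, not_or] at hh₂
  -- Removing the rim edges `(false, 0)` and `c` cuts the rim into two arcs; `p` and `q` give the
  -- value `h₁` on one and `h₂` on the other, so they disagree across exactly these two edges.
  let p : Fin (n + 2) → Γ := fun i ↦ if 1 ≤ i.val ∧ i.val ≤ c.2.val then h₁ else h₂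
  let q : Fin (n + 2) → Γ := fun i ↦ if i.val < c.2.val ∨ (i = c.2 ∧ c.1 = true) then h₁ else h₂
  have hp : ∀ i, p i ≠ 1 := by intro i; simp only [p]; split_ifs; exacts [hh₁, hh₂.2]
  have hq : ∀ i, q i ≠ 1 := by intro i; simp only [q]; split_ifs; exacts [hh₁, hh₂.2]
  have key : ∀ d : Index n, p (shift d) = q d.2 ↔ d ≠ c ∧ d ≠ (false, 0) := by
    intro d
    have hite : ∀ A B : Prop, ∀ [Decidable A] [Decidable B],
        ((if A then h₁ else h₂) = (if B then h₁ else h₂)) ↔ (A ↔ B) := by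
      intro A B _ _
      by_cases hA : A <;> by_cases hB : B <;> simp [hA, hB, hh₂.1, Ne.symm hh₂.1]
    simp only [p, q, hite]
    obtain ⟨b, i⟩ := d
    obtain ⟨c₁, j⟩ := c
    have hi := i.isLt
    have hj := j.isLt
    cases b <;> cases c₁ <;>
      simp only [shift, Prod.mk.injEq, ne_eq, Fin.ext_iff, Fin.val_add_one, Fin.val_zero,
        Fin.val_last, if_true, if_false, reduceCtorEq, Bool.false_eq_true, false_and, true_and,
        and_false, and_true, or_false, not_false_eq_true, iff_true] at hc ⊢
    · omega
    · omega
    · split_ifs <;> omega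
    · split_ifs <;> omega
  let P : Index n → Γ := fun d ↦ if d.1 then p d.2 else 1
  let Q : Index n → Γ := fun d ↦ if d.1 then q d.2 else 1
  -- With `g = 1` both unbalanced faces are at the apex `true`. For `e = false` the correction on
  -- `c` repairs `(true, c)` and spoils `(false, c)` instead.
  let g : Index n → Γ := fun d ↦ if e = false ∧ d = c then (p (shift c))⁻¹ * q c.2 else 1
  have hcc : p (shift c) ≠ q c.2 := fun h ↦ ((key c).1 h).1 rfl
  convert realizable₃_of_potential P Q g ?_ ?_ ?_ using 2
  · ext ⟨b, d⟩
    have := key d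
    have hcc' : (p (shift c))⁻¹ * q c.2 ≠ 1 := by rwa [Ne, inv_mul_eq_one]
    by_cases hd : d = c
    · subst hd
      cases b <;> cases e <;> simp [P, Q, g, hole, hcc', hcc, hc]
    · cases b <;> cases e <;> simp [P, Q, g, hole, hd, this]
  · intro b b' j
    cases b <;> cases b' <;> simp [P, hp, (hp _).symm]
  · intro b b' j
    cases b <;> cases b' <;> simp [Q, hq, (hq _).symm]
  · intro b b' d
    by_cases hd : e = false ∧ d = c
    · obtain ⟨rfl, rfl⟩ := hd
      cases b <;> cases b' <;> simp [P, Q, g, hq, hp]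
    · cases b <;> cases b' <;> simp [P, Q, g, hd, hp, (hq _).symm]

/-! ### From three classes to longer cycles -/

/-- For some labels in `Γ`, distinct within each of `t` parallel classes, a sequence of edges, one
from each class, has product `1` if and only if it is a face in `K`. -/
def Realizable (Γ : Type*) [Group Γ] (t : ℕ) (K : Set (Bool × Index n)) : Prop :=
  ∃ a : ℕ → Index n → Γ, (∀ i < t, (a i).Injective) ∧
    ∀ w : ℕ → Index n, ((List.range t).map fun i ↦ a i (w i)).prod = 1 ↔
      ∃ s ∈ K, ∀ i < t, w i = face s i

lemma Realizable₃.realizable {K : Set (Bool × Index n)} (h : Realizable₃ Γ (IsFace K)) :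
    Realizable Γ 3 K := by
  obtain ⟨a, b, c, ha, hb, hc, h⟩ := h
  refine ⟨fun i ↦ if i = 0 then a else if i = 1 then b else c, fun i hi ↦ ?_, fun w ↦ ?_⟩
  · interval_cases i <;> simpa
  · have : ((List.range 3).map fun i ↦
        (if i = 0 then a else if i = 1 then b else c) (w i)).prod = a (w 0) * b (w 1) * c (w 2) := by
      simp [List.range_succ, mul_assoc]
    rw [this, h]
    refine exists_congr fun s ↦ and_congr_right fun _ ↦ ⟨?_, fun h ↦ ?_⟩
    · rintro ⟨h₀, h₁, h₂⟩ i hi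
      interval_cases i <;> assumption
    · exact ⟨h 0 (by simp), h 1 (by simp), h 2 (by simp)⟩

lemma finite_setOf_prod {D : Type*} [Finite D] (a : ℕ → D → Γ) (t : ℕ) :
    {g | ∃ w : ℕ → D, ((List.range t).map fun i ↦ a i (w i)).prod = g}.Finite := by
  induction t with
  | zero => exact (Set.finite_singleton 1).subset (by rintro g ⟨w, rfl⟩; simp)
  | succ t ih =>
    refine (ih.image2 (fun g h ↦ g * h) (Set.finite_range (a t))).subset ?_
    rintro g ⟨w, rfl⟩
    refine ⟨_, ⟨w, rfl⟩, _, ⟨w t, rfl⟩, ?_⟩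
    simp [List.range_succ]

/-- Subdividing the edges of the last class, with generic labels, preserves realizability. -/
lemma Realizable.succ [Infinite Γ] {K : Set (Bool × Index n)} {r : ℕ} (hr : 2 ≤ r)
    (h : Realizable Γ (r + 1) K) : Realizable Γ (r + 2) K := by
  obtain ⟨a, ha, h⟩ := h
  let U := {g | ∃ w : ℕ → Index n, ((List.range (r + 1)).map fun i ↦ a i (w i)).prod = g}
  have : Finite U := finite_setOf_prod a (r + 1)
  obtain ⟨g, hg⟩ := exists_forall_not_of_update
    (σ := (Index n × Index n) ⊕ (Index n × Index n) ⊕ (U × Index n × Index n))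
    (ι := Index n) (Γ := Γ)
    (fun s g ↦ match s with
      | .inl (d, d') => d ≠ d' ∧ g d = g d'
      | .inr (.inl (d, d')) => d ≠ d' ∧ a r d * (g d)⁻¹ = a r d' * (g d')⁻¹
      | .inr (.inr (u, d, d')) => d ≠ d' ∧ u * (g d)⁻¹ * g d' = 1)
    (by
      rintro (⟨d, d'⟩ | ⟨d, d'⟩ | ⟨u, d, d'⟩)
      · refine ⟨d, fun x g ⟨h, h₁⟩ ⟨_, h₂⟩ ↦ ?_⟩
        rw [Function.update_self, Function.update_of_ne h.symm, ← h₁] at h₂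
        exact h₂
      · refine ⟨d, fun x g ⟨h, h₁⟩ ⟨_, h₂⟩ ↦ ?_⟩
        rw [Function.update_self, Function.update_of_ne h.symm, ← h₁] at h₂
        exact inv_injective (mul_left_cancel h₂)
      · refine ⟨d', fun x g ⟨h, h₁⟩ ⟨_, h₂⟩ ↦ ?_⟩
        rw [Function.update_self, Function.update_of_ne h, ← h₁] at h₂
        exact mul_left_cancel h₂)
  refine ⟨fun i d ↦ if i < r then a i d else if i = r then a r d * (g d)⁻¹ else g d,
    fun i hi d d' hd ↦ ?_, fun w ↦ ?_⟩
  · beta_reduce at hd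
    split_ifs at hd with h₁ h₂
    · exact ha i (by omega) hd
    · by_contra hne
      exact hg (.inr (.inl (d, d'))) ⟨hne, hd⟩
    · by_contra hne
      exact hg (.inl (d, d')) ⟨hne, hd⟩
  · have hprod : ((List.range (r + 2)).map fun i ↦
        if i < r then a i (w i) else if i = r then a r (w i) * (g (w i))⁻¹ else g (w i)).prod =
        ((List.range (r + 1)).map fun i ↦ a i (w i)).prod * (g (w r))⁻¹ * g (w (r + 1)) := by
      rw [List.range_succ, List.range_succ]
      have : (List.range r).map (fun i ↦ if i < r then a i (w i) else
          if i = r then a r (w i) * (g (w i))⁻¹ else g (w i)) =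
          (List.range r).map fun i ↦ a i (w i) := by
        refine List.map_congr_left fun i hi ↦ ?_
        rw [if_pos (List.mem_range.1 hi)]
      simp [this, mul_assoc]
    rw [hprod]
    -- Matching halves of a subdivided edge cancel to the old label; mismatched halves never give
    -- product 1, as there are only finitely many old products to avoid.
    by_cases hw : w r = w (r + 1)
    · rw [hw, inv_mul_cancel_right, h]
      refine exists_congr fun s ↦ and_congr_right fun _ ↦ ⟨fun h i hi ↦ ?_,
        fun h i hi ↦ h i (by omega)⟩
      by_cases hi' : i = r + 1
      · subst hi'
        rw [← hw, h r (by omega), face_of_two_le s hr, face_of_two_le s (by omega)]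
      · exact h i (by omega)
    · constructor
      · intro h'
        exact absurd ⟨hw, h'⟩ (hg (.inr (.inr (⟨_, w, rfl⟩, w r, w (r + 1)))))
      · rintro ⟨s, -, hs⟩
        refine absurd ?_ hw
        rw [hs r (by omega), hs (r + 1) (by omega), face_of_two_le s hr,
          face_of_two_le s (by omega)]

lemma Realizable₃.realizable_add [Infinite Γ] {K : Set (Bool × Index n)}
    (h : Realizable₃ Γ (IsFace K)) (r : ℕ) : Realizable Γ (r + 3) K := by
  induction r with
  | zero => exact h.realizable
  | succ r ih => exact Realizable.succ (by omega) ih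

/-! ### The face sets needed for one deletion or contraction -/

lemma face_min_two (s : Bool × Index n) (i : ℕ) : face s i = face s (min i 2) := by
  rcases le_total i 2 with h | h
  · rw [min_eq_left h]
  · rw [min_eq_right h, face_of_two_le s h, face_two]

-- A face through `d`, other than the hole, may be unbalanced as well, because making `d` generic
-- destroys it anyway. If `d` is the rim edge of the hole, the hole is itself destroyed, and one
-- starts from all faces balanced.
variable (Γ) in
lemma realizable_avoid [Infinite Γ] (r i : ℕ) (d : Index n) :
    Realizable Γ (r + 3) {s | s ≠ hole n ∧ face s i ≠ d} := by
  refine Realizable₃.realizable_add ?_ r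
  simp_rw [face_min_two _ i]
  generalize hj : min i 2 = j
  have hj' : j < 3 := by omega
  have of_pair : ∀ e c, c ≠ (false, 0) → face (e, c) j = d →
      Realizable₃ Γ (IsFace {s | s ≠ hole n ∧ face s j ≠ d}) := by
    intro e c hc hd
    convert (realizable₃_compl_pair Γ e c hc).avoid hj' d using 2
    ext s
    simp only [Set.mem_ofPred_eq]
    refine ⟨fun ⟨h₁, h₂⟩ ↦ ⟨⟨h₁, ?_⟩, h₂⟩, fun ⟨⟨h₁, _⟩, h₂⟩ ↦ ⟨h₁, h₂⟩⟩
    rintro rfl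
    exact h₂ hd
  obtain ⟨e, b⟩ := d
  clear hj
  interval_cases j
  -- A rim edge with first component `true` differs from the rim edge of the hole; the next case
  -- uses the same choice.
  · exact of_pair e (true, b) (by simp) rfl
  · exact of_pair e (true, b - 1) (by simp) (by simp [shift])
  · by_cases hd : (e, b) = (false, 0)
    · convert (realizable₃_univ (n := n) Γ).avoid hj' (e, b) using 2
      ext s
      simp only [Set.mem_ofPred_eq, Set.mem_univ, true_and, and_iff_right_iff_imp]
      rintro h rfl
      exact h hd.symm
    · exact of_pair true (e, b) hd rfl

-- Start from all faces balanced and make every other edge in the class of `d` generic. If the hole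
-- passes through `d`, spoil a second edge of the hole: no other face contains both edges.
variable (Γ) in
lemma realizable_through [Infinite Γ] (r i : ℕ) (d : Index n) :
    Realizable Γ (r + 3) {s | s ≠ hole n ∧ face s i = d} := by
  classical
  refine Realizable₃.realizable_add ?_ r
  simp_rw [face_min_two _ i]
  generalize hj : min i 2 = j
  have hj' : j < 3 := by omega
  have h := (realizable₃_univ (n := n) Γ).avoid_finset hj' (Finset.univ.erase d)
  simp only [Set.mem_univ, Finset.mem_erase, Finset.mem_univ, and_true, true_and, not_not] at h
  by_cases hd : face (hole n) j = d
  · obtain ⟨l, hl, hjl⟩ : ∃ l < 3, j ≠ l := by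
      by_cases h0 : j = 0
      · exact ⟨1, by simp, by simp [h0]⟩
      · exact ⟨0, by simp, h0⟩
    convert h.avoid hl (face (hole n) l) using 2
    ext s
    simp only [Set.mem_ofPred_eq]
    constructor
    · rintro ⟨h₁, h₂⟩
      exact ⟨h₂, fun h₃ ↦ h₁ (face_eq_of_two hj' hl hjl (h₂.trans hd.symm) h₃)⟩
    · rintro ⟨h₁, h₂⟩
      refine ⟨?_, h₁⟩
      rintro rfl
      exact h₂ rfl
  · convert h using 2
    ext s
    simp only [Set.mem_ofPred_eq, and_iff_right_iff_imp]
    rintro h rfl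
    exact hd h

/-! ### The obstruction to labelling -/

/-- In any labelling for which all other faces have product `1`, so has the hole. -/
lemma prod_hole (r : ℕ) (a : ℕ → Index n → Γ)
    (h : ∀ s ≠ hole n, ((List.range (r + 3)).map fun i ↦ a i (face s i)).prod = 1) :
    ((List.range (r + 3)).map fun i ↦ a i (face (hole n) i)).prod = 1 := by
  let c : Index n → Γ := fun d ↦ ((List.range (r + 1)).map fun i ↦ a (i + 2) d).prod
  have hprod : ∀ s, ((List.range (r + 3)).map fun i ↦ a i (face s i)).prod =
      a 0 (s.1, s.2.2) * a 1 (s.1, shift s.2) * c s.2 := by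
    intro s
    rw [List.range_succ_eq_map, List.range_succ_eq_map]
    simp only [List.map_cons, List.map_map, List.prod_cons, face_zero, face_one, mul_assoc]
    rfl
  simp only [hprod] at h ⊢
  -- `p` and `q` compare the two apices at the rim vertices. Eliminating `c` by the faces at the
  -- apex `false`, a face at the apex `true` says that the comparisons at the ends of its rim edge
  -- agree.
  let p : Fin (n + 2) → Γ := fun j ↦ a 1 (true, j) * (a 1 (false, j))⁻¹
  let q : Fin (n + 2) → Γ := fun j ↦ (a 0 (true, j))⁻¹ * a 0 (false, j)
  have hc : ∀ d, c d = (a 0 (false, d.2) * a 1 (false, shift d))⁻¹ := fun d ↦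
    eq_inv_of_mul_eq_one_right (h (false, d) (by simp [hole]))
  have hpq : ∀ d : Index n, a 0 (true, d.2) * a 1 (true, shift d) * c d = 1 ↔
      p (shift d) = q d.2 := by
    intro d
    rw [hc]
    simp only [p, q, mul_inv_rev]
    rw [mul_assoc, ← mul_assoc (a 1 _), ← mul_assoc, mul_inv_eq_one, eq_inv_mul_iff_mul_eq]
  have h₁ : ∀ j, p (j + 1) = q j := fun j ↦
    (hpq (true, j)).1 (h (true, true, j) (by simp [hole]))
  have h₀ : ∀ j ≠ 0, p j = q j := fun j hj ↦
    (hpq (false, j)).1 (h (true, false, j) (by simpa [hole] using hj))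
  have hq : ∀ j, q j = q 0 := by
    intro j
    induction j using Fin.induction with
    | zero => rfl
    | succ i ih =>
      rw [← ih, ← h₀ _ (Fin.succ_ne_zero i), ← h₁, Fin.coeSucc_eq_succ]
  refine (hpq (false, 0)).2 ?_
  -- The other rim edges form a path joining the ends of the hole's rim edge; `(true, Fin.last _)`
  -- is the edge that wraps around to `0`.
  change p 0 = q 0
  rw [← hq (Fin.last _), ← h₁, Fin.last_add_one]

end Bipyramid

/-! ### The thick cycle and its Hamiltonian cycles -/

namespace Bipyramid

open Graph
open scoped Fin.NatCast Fin.CommRing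

variable {n r : ℕ} {Γ : Type*} [Group Γ] {C : Set (Fin (r + 3) × Index n)}

/-- The cycle of length `r + 3` with `2 * (n + 2)` parallel edges in place of each edge. -/
def thickCycle (r n : ℕ) : Graph (Fin (r + 3)) (Fin (r + 3) × Index n) where
  vertexSet := Set.univ
  edgeSet := Set.univ
  IsLink e x y := (x = e.1 ∧ y = e.1 + 1) ∨ (x = e.1 + 1 ∧ y = e.1)
  isLink_symm _ _ := ⟨fun _ _ h ↦ h.symm.imp And.symm And.symm⟩
  eq_or_eq_of_isLink_of_isLink := by
    rintro e x y v w (⟨rfl, rfl⟩ | ⟨rfl, rfl⟩) (⟨rfl, rfl⟩ | ⟨rfl, rfl⟩) <;> simp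
  edge_mem_iff_exists_isLink e := by
    simp only [Set.mem_univ, true_iff]
    exact ⟨_, _, Or.inl ⟨rfl, rfl⟩⟩
  left_mem_of_isLink := by simp

lemma thickCycle_isLink {e : Fin (r + 3) × Index n} {x y : Fin (r + 3)} :
    (thickCycle r n).IsLink e x y ↔ (x = e.1 ∧ y = e.1 + 1) ∨ (x = e.1 + 1 ∧ y = e.1) := Iff.rfl

lemma isLink_self_add_one (e : Fin (r + 3) × Index n) :
    (thickCycle r n).IsLink e e.1 (e.1 + 1) := Or.inl ⟨rfl, rfl⟩

lemma add_one_ne (i : Fin (r + 3)) : i + 1 ≠ i := by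
  simp

/-- Ensures that distinct parallel classes join distinct pairs of vertices, which fails for a cycle
of length 2. -/
lemma add_one_add_one_ne (i : Fin (r + 3)) : i + 1 + 1 ≠ i := by
  intro h
  rw [add_assoc, add_eq_left] at h
  have h' := congrArg Fin.val h
  rw [Fin.val_add] at h'
  simp only [Fin.val_one, Fin.val_zero, Nat.reduceAdd] at h'
  rw [Nat.mod_eq_of_lt (by omega)] at h'
  simp at h'

instance : (thickCycle r n).Loopless where
  not_isLoopAt e x h := by
    rcases h with ⟨h₁, h₂⟩ | ⟨h₁, h₂⟩
    · exact add_one_ne _ (h₂.symm.trans h₁)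
    · exact add_one_ne _ (h₁.symm.trans h₂)

/-- The edge set of the cycle that uses the edge `w i` of the `i`-th class. -/
def wordSet (r : ℕ) (w : ℕ → Index n) : Set (Fin (r + 3) × Index n) := {e | e.2 = w e.1.val}

lemma mem_wordSet {w : ℕ → Index n} {e : Fin (r + 3) × Index n} :
    e ∈ wordSet r w ↔ e.2 = w e.1.val := Iff.rfl

lemma wordSet_eq_iff {w w' : ℕ → Index n} :
    wordSet r w = wordSet r w' ↔ ∀ i < r + 3, w i = w' i := by
  refine ⟨fun h i hi ↦ ?_, fun h ↦ ?_⟩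
  · have : ((⟨i, hi⟩, w i) : Fin (r + 3) × Index n) ∈ wordSet r w := rfl
    rw [h] at this
    exact this
  · ext e
    rw [mem_wordSet, mem_wordSet, h _ e.1.isLt]

lemma isCycle_wordSet (w : ℕ → Index n) : (thickCycle r n).IsCycle (wordSet r w) := by
  let step : ℕ → (Fin (r + 3) × Index n) × Fin (r + 3) :=
    fun i ↦ (((i : Fin (r + 3)), w i), ((i + 1 : ℕ) : Fin (r + 3)))
  have hwalk : ∀ m : ℕ, (thickCycle r n).IsWalk 0 ((List.range m).map step) (m : Fin (r + 3)) := by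
    intro m
    induction m with
    | zero => exact ⟨Set.mem_univ _, by simp⟩
    | succ m ih =>
      rw [List.range_succ, List.map_append]
      refine ih.append ⟨Or.inl ⟨rfl, ?_⟩, Set.mem_univ _, rfl⟩
      simp
  have hinj : ∀ i ∈ List.range (r + 3), ∀ j ∈ List.range (r + 3),
      (i : Fin (r + 3)) = (j : Fin (r + 3)) → i = j := by
    intro i hi j hj h
    have := congrArg Fin.val h
    rwa [Fin.val_cast_of_lt (List.mem_range.1 hi), Fin.val_cast_of_lt (List.mem_range.1 hj)] at this
  refine ⟨0, (List.range (r + 3)).map step, ⟨?_, by simp, ?_, ?_⟩, ?_⟩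
  · simpa using hwalk (r + 3)
  · rw [List.map_map]
    refine List.Nodup.map_on (fun i hi j hj h ↦ hinj i hi j hj ?_) List.nodup_range
    exact congrArg Prod.fst h
  · rw [List.map_map]
    refine List.Nodup.map_on (fun i hi j hj h ↦ hinj i hi j hj ?_) List.nodup_range
    simpa [step] using h
  · ext ⟨i, d⟩
    simp only [mem_stepEdges, List.map_map, List.mem_map, List.mem_range, mem_wordSet,
      Function.comp_apply, step, Prod.mk.injEq]
    constructor
    · rintro ⟨j, hj, rfl, rfl⟩
      rw [Fin.val_cast_of_lt hj]
    · rintro rfl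
      exact ⟨i.val, i.isLt, by simp, rfl⟩

lemma endSet_wordSet (w : ℕ → Index n) : (thickCycle r n).endSet (wordSet r w) = Set.univ := by
  ext i
  simp only [Set.mem_univ, iff_true]
  exact ⟨(i, w i.val), rfl, _, isLink_self_add_one _⟩

/-- A cycle without parallel edges uses exactly one edge of each class. -/
lemma exists_eq_wordSet (hC : (thickCycle r n).IsCycle C)
    (h : ∀ i d d', (i, d) ∈ C → (i, d') ∈ C → d = d') : ∃ w, C = wordSet r w := by
  have hinj : Set.InjOn Prod.fst C := by
    rintro ⟨i, d⟩ hd ⟨j, d'⟩ hd' (rfl : i = j)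
    rw [h i d d' hd hd']
  have hsub : Prod.fst '' C ⊆ (thickCycle r n).endSet C := by
    rintro _ ⟨e, he, rfl⟩
    exact ⟨e, he, _, isLink_self_add_one e⟩
  -- There are as many used classes as vertices, so every vertex of `C` is the first end of one of
  -- its edges; hence the set of used classes is closed under adding 1.
  have heq : Prod.fst '' C = (thickCycle r n).endSet C :=
    Set.eq_of_subset_of_ncard_le hsub
      (by rw [hC.ncard_endSet, hinj.ncard_image]) (Set.toFinite _)
  obtain ⟨e₀, he₀⟩ := hC.nonempty
  have hall : ∀ m : ℕ, e₀.1 + (m : Fin (r + 3)) ∈ Prod.fst '' C := by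
    intro m
    induction m with
    | zero => exact ⟨e₀, he₀, by simp⟩
    | succ m ih =>
      obtain ⟨e, he, hm⟩ := ih
      rw [heq]
      refine ⟨e, he, e.1, ?_⟩
      rw [Nat.cast_succ, ← add_assoc, ← hm]
      exact (isLink_self_add_one e).symm
  have hex : ∀ i : Fin (r + 3), ∃ d, (i, d) ∈ C := by
    intro i
    obtain ⟨⟨j, d⟩, he, hi⟩ := hall (i - e₀.1).val
    rw [Fin.cast_val_eq_self, add_sub_cancel] at hi
    exact ⟨d, hi ▸ he⟩
  choose f hf using hex
  refine ⟨fun m ↦ f (m : Fin (r + 3)), ?_⟩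
  ext ⟨i, d⟩
  rw [mem_wordSet]
  simp only [Fin.cast_val_eq_self]
  exact ⟨fun hd ↦ h i d _ hd (hf i), fun hd ↦ hd ▸ hf i⟩

/-! ### Labellings of the thick cycle -/

lemma exists_potential_iff (A : ℕ → Γ) :
    (∃ p : Fin (r + 3) → Γ, ∀ i, p i * A i.val = p (i + 1)) ↔
      ((List.range (r + 3)).map A).prod = 1 := by
  constructor
  · rintro ⟨p, hp⟩
    have hpre : ∀ m ≤ r + 3, p 0 * ((List.range m).map A).prod = p (m : Fin (r + 3)) := by
      intro m hm
      induction m with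
      | zero => simp
      | succ m ih =>
        have := hp (m : Fin (r + 3))
        rw [Fin.val_cast_of_lt (by omega), ← ih (by omega)] at this
        rw [List.range_succ, Nat.cast_succ, ← this]
        simp [mul_assoc]
    simpa using hpre (r + 3) le_rfl
  · intro h
    refine ⟨fun i ↦ ((List.range i.val).map A).prod, fun i ↦ ?_⟩
    have hs : ((List.range i.val).map A).prod * A i.val =
        ((List.range (i.val + 1)).map A).prod := by
      simp [List.range_succ]
    beta_reduce
    rw [hs, Fin.val_add_one]
    split_ifs with hi
    · rw [hi, Fin.val_last, h]
      simp
    · rfl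

/-- The label of an edge, read in the direction of the cycle. -/
def forwardLabel (φ : (thickCycle r n).GroupLabelling Γ)
    (e : Fin (r + 3) × Index n) : Γ :=
  if φ.tail e = e.1 then φ.label e else (φ.label e)⁻¹

lemma isPotential_iff (φ : (thickCycle r n).GroupLabelling Γ) (p : Fin (r + 3) → Γ) :
    φ.IsPotential C p ↔ ∀ e ∈ C, p e.1 * forwardLabel φ e = p (e.1 + 1) := by
  classical
  refine ⟨fun h e he ↦ ?_, fun h e he ↦ ?_⟩
  · rw [forwardLabel, ← h.mul_step he (isLink_self_add_one e)]
    congr!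
  · refine GroupLabelling.isPotential_of_step (isLink_self_add_one e) ?_
    rw [← h e he, forwardLabel]
    congr!

lemma wordSet_mem_balancedCycles (φ : (thickCycle r n).GroupLabelling Γ) (w : ℕ → Index n) :
    wordSet r w ∈ φ.balancedCycles ↔
      ((List.range (r + 3)).map fun i : ℕ ↦ forwardLabel φ ((i : Fin (r + 3)), w i)).prod = 1 := by
  rw [φ.mem_balancedCycles_iff, and_iff_right (isCycle_wordSet w), ← exists_potential_iff]
  refine exists_congr fun p ↦ ?_
  rw [isPotential_iff]
  constructor
  · intro h i
    simpa using h (i, w i.val) rfl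
  · rintro h ⟨i, d⟩ (rfl : d = w i.val)
    simpa using h i

/-! ### The biased graph of faces -/

/-- The thick cycle with the faces in `K` as its balanced cycles. -/
def faceGraph (r : ℕ) (K : Set (Bool × Index n)) :
    MarkedGraph (Fin (r + 3)) (Fin (r + 3) × Index n) where
  graph := thickCycle r n
  balanced := {C | ∃ s ∈ K, C = wordSet r (face s)}

/-- Distinct labels within each class keep a balanced cycle from using two parallel edges, so only
Hamiltonian cycles can be balanced. -/
lemma Realizable.labellable {K : Set (Bool × Index n)} (h : Realizable Γ (r + 3) K) :
    (faceGraph r K).Labellable Γ := by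
  obtain ⟨a, ha, h⟩ := h
  let φ : (thickCycle r n).GroupLabelling Γ :=
    { tail := fun e ↦ e.1
      head := fun e ↦ e.1 + 1
      isLink := fun e _ ↦ isLink_self_add_one e
      label := fun e ↦ a e.1.val e.2 }
  have hφ : ∀ e, forwardLabel φ e = a e.1.val e.2 := fun e ↦ if_pos rfl
  have hw : ∀ w, wordSet r w ∈ φ.balancedCycles ↔ ∃ s ∈ K, ∀ i < r + 3, w i = face s i := by
    intro w
    rw [wordSet_mem_balancedCycles, ← h]
    have : (List.range (r + 3)).map (fun i : ℕ ↦ forwardLabel φ ((i : Fin (r + 3)), w i)) =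
        (List.range (r + 3)).map fun i ↦ a i (w i) := by
      refine List.map_congr_left fun i hi ↦ ?_
      rw [hφ, Fin.val_cast_of_lt (List.mem_range.1 hi)]
    rw [this]
  refine ⟨φ, ?_⟩
  ext C
  change C ∈ φ.balancedCycles ↔ ∃ s ∈ K, C = wordSet r (face s)
  constructor
  · intro hC
    obtain ⟨w, rfl⟩ : ∃ w, C = wordSet r w := by
      obtain ⟨hcyc, p, hp⟩ := φ.mem_balancedCycles_iff.1 hC
      rw [isPotential_iff] at hp
      refine exists_eq_wordSet hcyc fun i d d' hd hd' ↦ ha i.val i.isLt ?_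
      have h₁ := hp _ hd
      rw [← hp _ hd', hφ, hφ] at h₁
      exact mul_left_cancel h₁
    obtain ⟨s, hs, hws⟩ := (hw w).1 hC
    exact ⟨s, hs, wordSet_eq_iff.2 hws⟩
  · rintro ⟨s, hs, rfl⟩
    exact (hw _).2 ⟨s, hs, fun _ _ ↦ rfl⟩

lemma face_eq_of_forall_ne {s s' : Bool × Index n} (i : ℕ)
    (h : ∀ j < 3, j ≠ i → face s j = face s' j) : s = s' := by
  by_cases h₀ : i = 0
  · exact face_eq_of_two (i := 1) (j := 2) (by simp) (by simp) (by simp)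
      (h 1 (by simp) (by omega)) (h 2 (by simp) (by omega))
  · by_cases h₁ : i = 1
    · exact face_eq_of_two (i := 0) (j := 2) (by simp) (by simp) (by simp)
        (h 0 (by simp) (by omega)) (h 2 (by simp) (by omega))
    · exact face_eq_of_two (i := 0) (j := 1) (by simp) (by simp) (by simp)
        (h 0 (by simp) (by omega)) (h 1 (by simp) (by omega))

/-- The theta condition holds vacuously: two distinct Hamiltonian cycles in a common theta differ in
a single class, whereas distinct faces differ in at least two of the first three. -/
lemma faceGraph_isBiased (r : ℕ) (K : Set (Bool × Index n)) : (faceGraph r K).IsBiased where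
  finite_vertexSet := Set.toFinite _
  finite_edgeSet := Set.toFinite _
  isCycle := by
    rintro _ ⟨s, -, rfl⟩
    exact isCycle_wordSet _
  theta := by
    rintro x y P Q R h ⟨s, -, hs⟩ ⟨s', -, hs'⟩
    exfalso
    have hx : x ∉ Q.map Prod.snd := (List.nodup_cons.1 h.isPath₂.vertices_nodup).1
    cases Q with
    | nil => exact h.ne h.isPath₂.isWalk.2
    | cons q Q =>
      obtain ⟨⟨i, d⟩, z⟩ := q
      have hiQ : ((i, d) : Fin (r + 3) × Index n) ∈ stepEdges (((i, d), z) :: Q) := by simp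
      have hd : ((i, d) : Fin (r + 3) × Index n) ∈ wordSet r (face s) :=
        hs ▸ Set.mem_union_right _ hiQ
      -- The first edge of `Q` is the only edge of class `i` in `P ∪ Q`, so the edge of this class
      -- in `P ∪ R` lies in `R`. Then `Q` and `R` share the next vertex, which must be `y`, and `Q`
      -- is a single edge.
      have hs'P : ∀ f ∈ stepEdges P, f.1 ≠ i := by
        intro f hf hfi
        have hf' : f ∈ wordSet r (face s) := hs ▸ Set.mem_union_left _ hf
        refine Set.disjoint_left.1 h.disjoint₁₂.1 hf ?_
        have hfd : f = (i, d) := Prod.ext hfi (by rw [mem_wordSet.1 hf', hfi, ← mem_wordSet.1 hd])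
        rwa [hfd]
      have hR : ((i, face s' i.val) : Fin (r + 3) × Index n) ∈ stepEdges R := by
        have : ((i, face s' i.val) : Fin (r + 3) × Index n) ∈ wordSet r (face s') := rfl
        rw [← hs'] at this
        exact this.resolve_left fun h' ↦ hs'P _ h' rfl
      have hzy : z = y := by
        refine h.disjoint₂₃.2 z (by simp) ?_
        have hz : z ∈ x :: R.map Prod.snd := by
          refine h.isPath₃.isWalk.mem_of_inc hR ?_
          rcases h.isPath₂.isWalk.1 with ⟨h₁, h₂⟩ | ⟨h₁, h₂⟩
          · exact ⟨i, Or.inr ⟨h₂, rfl⟩⟩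
          · exact ⟨i + 1, Or.inl ⟨h₂, rfl⟩⟩
        refine (List.mem_cons.1 hz).resolve_left ?_
        rintro rfl
        simp at hx
      subst hzy
      have hQ : Q = [] := IsPath.eq_nil (G := thickCycle r n) (x := z)
        ⟨h.isPath₂.isWalk.2, (List.nodup_cons.1 h.isPath₂.vertices_nodup).2⟩
      subst hQ
      have hss : s = s' := by
        refine face_eq_of_forall_ne i.val fun j hj hji ↦ ?_
        have hjr : j < r + 3 := by omega
        have h₁ : ((⟨j, hjr⟩, face s j) : Fin (r + 3) × Index n) ∈ wordSet r (face s) := rfl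
        rw [← hs] at h₁
        rcases h₁ with h₁ | h₁
        · have : ((⟨j, hjr⟩, face s j) : Fin (r + 3) × Index n) ∈ wordSet r (face s') :=
            hs' ▸ Set.mem_union_left _ h₁
          exact this
        · simp only [stepEdges_cons, stepEdges_nil, insert_empty_eq, Set.mem_singleton_iff,
            Prod.mk.injEq] at h₁
          exact absurd (congrArg Fin.val h₁.1) hji
      subst hss
      rw [mem_wordSet] at hd
      refine Set.disjoint_left.1 h.disjoint₂₃.1 hiQ ?_
      rwa [← hd] at hR

lemma not_groupLabellable (r n : ℕ) :
    ¬ MarkedGraph.GroupLabellable.{u} (faceGraph r {s | s ≠ hole n}) := by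
  rintro ⟨Γ, _, φ, hφ⟩
  change (thickCycle r n).GroupLabelling Γ at φ
  change φ.balancedCycles = _ at hφ
  have hprod := prod_hole r (fun i d ↦ forwardLabel φ ((i : Fin (r + 3)), d)) fun s hs ↦ by
    rw [← wordSet_mem_balancedCycles, hφ]
    exact ⟨s, hs, rfl⟩
  rw [← wordSet_mem_balancedCycles, hφ] at hprod
  obtain ⟨s, hs, h⟩ := hprod
  rw [wordSet_eq_iff] at h
  exact hs (face_eq_of_forall_ne 0 fun j hj _ ↦ (h j (by omega)).symm)

/-- Faces through `e` vanish with it, so a labelling realizing only the faces that avoid `e` has the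
same deletion. -/
lemma labellable_delete [Infinite Γ] (e : Fin (r + 3) × Index n) :
    ((faceGraph r {s | s ≠ hole n}).delete e).Labellable Γ := by
  have h := (realizable_avoid Γ r e.1.val e.2).labellable.delete e
  convert h using 1
  simp only [MarkedGraph.delete, faceGraph, MarkedGraph.mk.injEq, true_and]
  ext C
  constructor
  · rintro ⟨⟨s, hs, rfl⟩, he⟩
    exact ⟨⟨s, ⟨hs, fun h ↦ he h.symm⟩, rfl⟩, he⟩
  · rintro ⟨⟨s, hs, rfl⟩, he⟩
    exact ⟨⟨s, hs.1, rfl⟩, he⟩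

lemma labellable_contractLink [Infinite Γ] {e : Fin (r + 3) × Index n} {x y : Fin (r + 3)}
    (he : (thickCycle r n).IsLink e x y) (hxy : x ≠ y) :
    ((faceGraph r {s | s ≠ hole n}).contractLink e x y).Labellable Γ := by
  have h := (realizable_through Γ r e.1.val e.2).labellable.contractLink he hxy
  convert h using 1
  simp only [MarkedGraph.contractLink, faceGraph, MarkedGraph.mk.injEq, true_and]
  ext C
  refine and_congr_right fun hC ↦ ?_
  -- A Hamiltonian cycle meets both ends of `e` and is no cycle after the contraction, so only faces
  -- through `e` contribute.
  have hno : ∀ s, C ≠ wordSet r (face s) := by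
    rintro s rfl
    refine hC.not_mem_and_mem (isCycle_wordSet _) hxy ?_
    simp [endSet_wordSet]
  constructor
  · rintro (⟨s, -, h⟩ | ⟨s, hs, h⟩)
    · exact absurd h (hno s)
    · refine Or.inr ⟨s, ⟨hs, ?_⟩, h⟩
      have : e ∈ wordSet r (face s) := h ▸ Set.mem_union_right _ rfl
      exact this.symm
  · rintro (⟨s, -, h⟩ | ⟨s, hs, h⟩)
    · exact absurd h (hno s)
    · exact Or.inr ⟨s, hs.1, h⟩

lemma labellable_of_hasProperMinor [Infinite Γ] {l : LoopRule}
    {Ω : MarkedGraph (Fin (r + 3)) (Fin (r + 3) × Index n)}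
    (h : MarkedGraph.HasProperMinor l (faceGraph r {s | s ≠ hole n}) Ω) : Ω.Labellable Γ := by
  refine h.labellable fun Ω₁ hs ↦ ?_
  cases hs with
  | delete he => exact labellable_delete _
  | contractLink he hxy => exact labellable_contractLink he hxy
  | contractBalancedLoop he hb => exact absurd he (not_isLoopAt (thickCycle r n) _ _)
  | contractUnbalancedLoop he hb => exact absurd he (not_isLoopAt (thickCycle r n) _ _)

/-! ### The underlying simple graph and edge multiplicities -/

lemma thickCycle_adj {x y : Fin (r + 3)} :
    (thickCycle r n).Adj x y ↔ y = x + 1 ∨ x = y + 1 := by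
  constructor
  · rintro ⟨e, ⟨rfl, rfl⟩ | ⟨rfl, rfl⟩⟩ <;> simp
  · rintro (rfl | rfl)
    · exact ⟨(x, false, 0), isLink_self_add_one _⟩
    · exact ⟨(y, false, 0), (isLink_self_add_one _).symm⟩

/-- The simplification of the thick cycle is a cycle. -/
def toSimpleGraphIso (r n : ℕ) :
    (thickCycle r n).toSimpleGraph ≃g SimpleGraph.cycleGraph (r + 3) where
  toEquiv := Equiv.Set.univ _
  map_rel_iff' := by
    rintro ⟨x, hx⟩ ⟨y, hy⟩
    rw [toSimpleGraph_adj_iff, thickCycle_adj]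
    change (SimpleGraph.cycleGraph (r + 1 + 2)).Adj x y ↔ _
    rw [SimpleGraph.cycleGraph_adj, sub_eq_iff_eq_add', sub_eq_iff_eq_add', or_comm,
      add_comm y, add_comm x]

lemma ncard_isLink {x y : Fin (r + 3)} (h : (thickCycle r n).Adj x y) :
    {e | (thickCycle r n).IsLink e x y}.ncard = 2 * (n + 2) := by
  have key : ∀ i : Fin (r + 3), {e | (thickCycle r n).IsLink e i (i + 1)}.ncard = 2 * (n + 2) := by
    intro i
    have : {e | (thickCycle r n).IsLink e i (i + 1)} =
        (fun d : Index n ↦ (i, d)) '' Set.univ := by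
      ext ⟨j, d⟩
      simp only [Set.mem_ofPred_eq, thickCycle_isLink, Set.image_univ, Set.mem_range,
        Prod.mk.injEq, exists_eq_right]
      constructor
      · rintro (⟨rfl, -⟩ | ⟨rfl, h⟩)
        · rfl
        · exact absurd h (add_one_add_one_ne j)
      · rintro rfl
        exact Or.inl ⟨rfl, rfl⟩
    rw [this, Set.ncard_image_of_injective _ (Prod.mk_right_injective i), Set.ncard_univ]
    simp
  rcases thickCycle_adj.1 h with rfl | rfl
  · exact key x
  · simp_rw [(thickCycle r n).isLink_comm]
    exact key y

end Bipyramid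

theorem theorem4p2 (k t : ℕ) (hk : 2 ≤ k) (ht : t = 3 ∨ 5 ≤ t) :
    ∃ (α β : Type) (Ω : MarkedGraph α β), Ω.IsBiased ∧
      Ω.graph.Loopless ∧
      Nonempty (Ω.graph.toSimpleGraph ≃g SimpleGraph.cycleGraph t) ∧
      (∀ x y, x ≠ y → Ω.graph.Adj x y → {e | Ω.graph.IsLink e x y}.ncard = 2 * k) ∧
      ¬ MarkedGraph.GroupLabellable.{u} Ω ∧
      ∀ (Γ : Type v) [Group Γ] [Infinite Γ] (r : LoopRule) (Ω' : MarkedGraph α β),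
        MarkedGraph.HasProperMinor r Ω Ω' → Ω'.Labellable Γ := by
  obtain ⟨n, rfl⟩ := Nat.exists_eq_add_of_le' hk
  obtain ⟨r, rfl⟩ : ∃ r, t = r + 3 := ⟨t - 3, by omega⟩
  exact ⟨Fin (r + 3), Fin (r + 3) × Bipyramid.Index n,
    Bipyramid.faceGraph r {s | s ≠ Bipyramid.hole n}, Bipyramid.faceGraph_isBiased r _,
    inferInstanceAs (Bipyramid.thickCycle r n).Loopless, ⟨Bipyramid.toSimpleGraphIso r n⟩,
    fun x y _ h ↦ Bipyramid.ncard_isLink h, Bipyramid.not_groupLabellable r n,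
    fun Γ _ _ l Ω' h ↦ Bipyramid.labellable_of_hasProperMinor h⟩
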